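/- **Problem.** Let $\mathbb R^n=\mathbb R^{n_1}\times\dots\times\mathbb R^{n_B}$ with the Euclidean norm, let $x_{(i)}\in\mathbb R^{n_i}$ be the $i$-th block of $x$, and let $f(x)=\sum_{i=1}^B p_i\|x_{(i)}\|$ with $p_i>0$. Let $g:\mathbb R^n\to\mathbb R$ be $\mu$-strongly convex, $\mu>0$, and consider $$\min_x f(x)\quad\text{s.t.}\quad g(x)\le 0 .$$ Assume that $g(\tilde x)<0$ for a known point $\tilde x$, and that $g(x_0^*)>0$ for every minimizer $x_0^*$ of $f$ over $\mathbb R^n$. Let $x_g$ be the minimizer of $g$, let $\zeta>0$ and $$\mathcal X=\Big\{x:\|x-\tilde x\|\le 2\sqrt{-2g(x_g)/\mu}+\zeta\Big\}.$$ Assume that $g$ is differentiable at the points of $\mathcal X$ and that on $\mathcal X$ the map $\nabla g$ is $L_X$-Lipschitz and $g$ is $L_G$-Lipschitz, with $L_X,L_G>0$. Put $\bar c=\frac{f(\tilde x)-\min f}{-g(\tilde x)}$, $\mathcal Y=\{y\in\mathbb R:|y|\le\bar c\}$, $L_{XY}=\bar cL_X$, and let $D_X,D_Y$ be the diameters of $\mathcal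 X,\mathcal Y$. Let $x^*$ be an optimal solution with Lagrange multiplier $y^*$, i.e. $y^*\ge0$, $0\in\partial_x\mathcal L(x^*,y^*)$ and $y^*g(x^*)=0$, where $\mathcal L(x,y)=f(x)+y\,g(x)$. Assume that it is non-degenerate: $0\in\operatorname{ri}\partial_x\mathcal L(x^*,y^*)$. Let $r>0$ be such that $\|\xi\|\ge r$ for all $\xi\in\partial f(x^*)$. The active set $\mathcal A(x^*)$ is the set of all $i$ for which the subdifferential of $p_i\|\cdot\|$ at $x^*_{(i)}$ is not a singleton, and $\eta=\min_{i\in\mathcal A(x^*)}\{p_i-\|[y^*\nabla g(x^*)]_{(i)}\|\}$ (with $\eta=0$ if $\mathcal A(x^*)=\emptyset$). **Algorithm (rAPDPro).** Inputs: $\bar\sigma>0$, $\nu_0,\delta\in(0,1)$, an initial pair in $\mathcal X\times\mathcal Y$, and an initial $\rho$ with $0\le\rho\le\mu y^*$. Set $\bar\tau=(1-\nu_0)(L_{XY}+L_G^2\bar\sigma/\delta)^{-1}$ and $\Delta=\frac1{\bar\tau}D_X^2+\frac1{2\bar\sigma}D_Y^2$. Epoch $s=0,1,2,\dots$ starts from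 the last pair and the last $\rho$ of the previous epoch (epoch $0$ from the inputs), called $(x_0,y_0)$ and $\rho_0$, with $x_{-1}=\bar x_0=x_0$, $\sigma_{-1}=\sigma_0=\bar\sigma$, $\tau_{-1}=\tau_0=\bar\tau$, $T_0=0$. For $k=0,1,2,\dots$ it computes $$\mathcal Y_k=\{y\ge0:\mu|y|\ge\rho_k\}\cap\mathcal Y,\qquad z_k=\Big(1+\frac{\sigma_{k-1}}{\sigma_k}\Big)g(x_k)-\frac{\sigma_{k-1}}{\sigma_k}g(x_{k-1}),$$ $$y_{k+1}=\operatorname*{argmin}_{y\in\mathcal Y_k}|y-(y_k+\sigma_kz_k)|^2,\qquad x_{k+1}=\operatorname*{argmin}_{x\in\mathcal X}\Big\{f(x)+\langle y_{k+1}\nabla g(x_k),x\rangle+\frac1{2\tau_k}\|x-x_k\|^2\Big\},$$ $$t_k=\frac{\sigma_k}{\sigma_0},\qquad \bar x_{k+1}=\frac{T_k\bar x_k+t_kx_{k+1}}{T_k+t_k},\qquad T_{k+1}=T_k+t_k,$$ $$\rho_{k+1}=\max\Big\{\rho_k,\ \mu\, h_1\Big(x_k,\frac{\sigma_0\tau_{k-1}\Delta}{\sigma_{k-1}}\Big),\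 \mu\, h_2\Big(\bar x_k,\frac{\Delta}{T_k}\Big)\Big\},\qquad \tau_{k+1}=\frac{\tau_k}{\sqrt{1+\rho_{k+1}\tau_k}},\qquad \sigma_{k+1}=\frac{\sigma_k\tau_k}{\tau_{k+1}},$$ where $$h_1(x,\beta)=\frac{r}{\|\nabla g(x)\|+L_X\sqrt{2\beta}},\qquad h_2(x,\beta)=\Big[\frac{L_X}{r}\sqrt{\frac{\beta}{2\mu}}+\sqrt{\frac{L_X^2\beta}{2\mu r^2}+\frac{\|\nabla g(x)\|}{r}}\Big]^{-2}$$ and the $h_2$-term is omitted for $k=0$ (as $\Delta/T_0=\infty$). It also computes $\hat\rho_1=3\sqrt{\rho_1/\bar\tau}$ and $\hat\rho_{k+1}=\frac1{k+1}\sqrt{\hat\rho_k^2k^2+3\rho_{k+1}\hat\rho_kk}$ for $k\ge1$. The epoch stops after $N_s$ iterations, where $N_s$ is the first $k\ge1$ with $$k\ \ge\ \Big\lceil\max\Big\{\frac{6}{\hat\rho_k\bar\tau},\ (\sqrt2)^s\,\frac{3\sqrt2\,D_Y}{\hat\rho_kD_X\sqrt{\bar\tau\bar\sigma}}\Big\}\Big\rceil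 .$$ Let $x_k^s$ denote the iterates $x_k$ of epoch $s$. **Theorem.** Suppose that $3L_{XY}\big(\bar\tau+(2L_{XY})^{-1}\big)\zeta>\eta\bar\tau$. Then every epoch stops after finitely many iterations, and there is an epoch $\hat S_0$ such that $$x^s_{k,(i)}=x^*_{(i)}=0\qquad\text{for all } s\ge\hat S_0,\ k\in\{1,\dots,N_s\},\ i\in\mathcal A(x^*).$$ -/

import Mathlib

noncomputable section

namespace RAPDPro

/-! ## Convex-analytic notions -/

/-- The subdifferential of a convex function `h` at `x`. -/
def subdifferential {E : Type*} [NormedAddCommGroup E] [InnerProductSpace ℝ E]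
    (h : E → ℝ) (x : E) : Set E :=
  {v | ∀ z, h x + inner ℝ v (z - x) ≤ h z}

/-- The Lagrangian `f x + y * g x` of `min f x` subject to `g x ≤ 0`. -/
def lagrangian {E : Type*} (f g : E → ℝ) (x : E) (y : ℝ) : ℝ := f x + y * g x

/-- `x` is an optimal solution of `min f` subject to `g ≤ 0`. -/
def IsSolution {E : Type*} (f g : E → ℝ) (x : E) : Prop :=
  g x ≤ 0 ∧ ∀ z, g z ≤ 0 → f x ≤ f z

/-- `y` is a Lagrange multiplier for `x` (KKT condition):
`y ≥ 0`, `0 ∈ ∂ₓ L(x, y)` and `y * g x = 0`. -/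
def IsMultiplier {E : Type*} [NormedAddCommGroup E] [InnerProductSpace ℝ E]
    (f g : E → ℝ) (x : E) (y : ℝ) : Prop :=
  0 ≤ y ∧ (0 : E) ∈ subdifferential (fun z => lagrangian f g z y) x ∧ y * g x = 0

/-- Non-degeneracy: `0` lies in the relative interior of `∂ₓ L(x, y)`. -/
def IsNondegenerate {E : Type*} [NormedAddCommGroup E] [InnerProductSpace ℝ E]
    (f g : E → ℝ) (x : E) (y : ℝ) : Prop :=
  (0 : E) ∈ intrinsicInterior ℝ (subdifferential (fun z => lagrangian f g z y) x)

/-- A minimizer of `φ` over `s` (an arbitrary point if there is none). -/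
def argminOn {α : Type*} [Nonempty α] (s : Set α) (φ : α → ℝ) : α :=
  Classical.epsilon fun a => a ∈ s ∧ ∀ b ∈ s, φ a ≤ φ b

/-! ## The group Lasso -/

/-- `ℝⁿ = ℝ^{d 0} × ⋯ × ℝ^{d (B-1)}` with its Euclidean norm; `x i` is the `i`-th block of `x`. -/
abbrev BlockSpace {B : ℕ} (d : Fin B → ℕ) : Type :=
  PiLp 2 (fun i : Fin B => EuclideanSpace ℝ (Fin (d i)))

/-- The group Lasso regularizer `∑ i, p i * ‖x i‖`. -/
def groupLasso {B : ℕ} {d : Fin B → ℕ} (p : Fin B → ℝ) (x : BlockSpace d) : ℝ :=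
  ∑ i, p i * ‖x i‖

/-- The active set of `x`: the blocks `i` for which the subdifferential of `p i * ‖·‖` at `x i`
is not a singleton. -/
def activeSet {B : ℕ} {d : Fin B → ℕ} (p : Fin B → ℝ) (x : BlockSpace d) : Set (Fin B) :=
  {i | ¬ ∃ v, subdifferential (fun u : EuclideanSpace ℝ (Fin (d i)) => p i * ‖u‖) (x i) = {v}}

/-- `η = min_{i ∈ 𝒜(x)} (p i - ‖[y ∇g(x)]ᵢ‖)` (it is `0` if the active set is empty). -/
def etaRadius {B : ℕ} {d : Fin B → ℕ} (p : Fin B → ℝ) (g : BlockSpace d → ℝ)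
    (x : BlockSpace d) (y : ℝ) : ℝ :=
  ⨅ i : activeSet p x, (p i - ‖(y • gradient g x) i‖)

/-! ## Problem data and algorithm parameters -/

/-- The data of a group Lasso problem with one constraint and the inputs of the algorithm. -/
structure Data {B : ℕ} (d : Fin B → ℕ) where
  /-- weights of the regularizer -/
  p : Fin B → ℝ
  /-- constraint function -/
  g : BlockSpace d → ℝ
  /-- strong convexity modulus of `g` -/
  mu : ℝ
  /-- strictly feasible point -/
  xTilde : BlockSpace d
  /-- minimizer of `g` -/
  xMin : BlockSpace d
  /-- enlargement of the ball -/
  zeta : ℝ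
  /-- lower bound on the norm of the subgradients of the regularizer at the solution -/
  r : ℝ
  /-- Lipschitz constant of the gradient of `g` on the ball -/
  LX : ℝ
  /-- Lipschitz constant of `g` on the ball -/
  LG : ℝ
  /-- initial dual step size of every epoch -/
  sigmaBar : ℝ
  nu0 : ℝ
  delta : ℝ
  /-- initial primal point -/
  xInit : BlockSpace d
  /-- initial dual point -/
  yInit : ℝ
  /-- initial estimate of the strong convexity of the Lagrangian -/
  rhoInit : ℝ

namespace Data

variable {B : ℕ} {d : Fin B → ℕ} (P : Data d)

/-- The objective. -/
def f : BlockSpace d → ℝ := groupLasso P.p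

/-- The enlarged ball `𝒳`. -/
def X : Set (BlockSpace d) :=
  Metric.closedBall P.xTilde (2 * √(-2 * P.g P.xMin / P.mu) + P.zeta)

/-- The upper bound `(f x̃ - min f) / (-g x̃)` on the multipliers. -/
def cBar : ℝ := (P.f P.xTilde - ⨅ x, P.f x) / (-P.g P.xTilde)

/-- The dual set `𝒴 = {y | ‖y‖₁ ≤ c̄}`. -/
def Y : Set ℝ := {y | |y| ≤ P.cBar}

/-- The diameter of `𝒳`. -/
def DX : ℝ := Metric.diam P.X

/-- The diameter of `𝒴`. -/
def DY : ℝ := Metric.diam P.Y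

/-- `L_{XY} = c̄ L_X`. -/
def LXY : ℝ := P.cBar * P.LX

/-- The initial primal step size of every epoch. -/
def tauBar : ℝ := (1 - P.nu0) * (P.LXY + P.LG ^ 2 * P.sigmaBar / P.delta)⁻¹

/-- The constant `Δ_{XY}`. -/
def DeltaXY : ℝ := 1 / P.tauBar * P.DX ^ 2 + 1 / (2 * P.sigmaBar) * P.DY ^ 2

/-! ## The algorithm -/

/-- Dual lower bound from a point `x` with `‖x - x*‖² ≤ 2β`. -/
def h1 (x : BlockSpace d) (β : ℝ) : ℝ :=
  P.r * (‖gradient P.g x‖ + P.LX * √(2 * β))⁻¹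

/-- Dual lower bound from a point `x` with `y* μ ‖x - x*‖² ≤ 2β`. -/
def h2 (x : BlockSpace d) (β : ℝ) : ℝ :=
  ((P.LX / P.r * √(β / (2 * P.mu))
    + √(P.LX ^ 2 * β / (2 * P.mu * P.r ^ 2) + ‖gradient P.g x‖ / P.r)) ^ 2)⁻¹

end Data

/-- The variables of an epoch before its iteration `k`:
`xPrev = x_{k-1}`, `x = x_k`, `xBar = x̄_k`, `y = y_k`, `sigmaPrev = σ_{k-1}`, `sigma = σ_k`,
`tauPrev = τ_{k-1}`, `tau = τ_k`, `T = T_k`, `rho = ρ_k`, `rhoHat = ρ̂_k`. -/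
structure State {B : ℕ} (d : Fin B → ℕ) where
  xPrev : BlockSpace d
  x : BlockSpace d
  xBar : BlockSpace d
  y : ℝ
  sigmaPrev : ℝ
  sigma : ℝ
  tauPrev : ℝ
  tau : ℝ
  T : ℝ
  rho : ℝ
  rhoHat : ℝ

/-- What an epoch hands over to the next one. -/
structure EpochInput {B : ℕ} (d : Fin B → ℕ) where
  x : BlockSpace d
  y : ℝ
  rho : ℝ

namespace Data

variable {B : ℕ} {d : Fin B → ℕ} (P : Data d)

/-- The cut dual set `𝒴_k = {y ≥ 0 | ‖y‖₁ μ ≥ ρ_k} ∩ 𝒴`. -/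
def Ycut (rho : ℝ) : Set ℝ := {y | 0 ≤ y ∧ rho ≤ |y| * P.mu} ∩ P.Y

/-- `y_{k+1}`: projection onto `𝒴_k` of the dual ascent step with the extrapolated
constraint value `z_k`. -/
def nextY (st : State d) : ℝ :=
  argminOn (P.Ycut st.rho) fun y =>
    ‖y - (st.y + st.sigma * ((1 + st.sigmaPrev / st.sigma) * P.g st.x
      - st.sigmaPrev / st.sigma * P.g st.xPrev))‖ ^ 2

/-- `x_{k+1}`: the proximal step on `𝒳`. -/
def nextX (st : State d) : BlockSpace d :=
  argminOn P.X fun u =>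
    P.f u + inner ℝ (P.nextY st • gradient P.g st.x) u + 1 / (2 * st.tau) * ‖u - st.x‖ ^ 2

/-- `ρ_{k+1}` (the Improve step). For `k = 0` one has `T_0 = 0`, so that `Δ_{XY} / T_0 = ∞` and
the second bound is void. -/
def nextRho (k : ℕ) (st : State d) : ℝ :=
  let b1 := P.h1 st.x (P.sigmaBar * st.tauPrev * P.DeltaXY / st.sigmaPrev)
  let b2 := if k = 0 then 0 else P.h2 st.xBar (P.DeltaXY / st.T)
  max st.rho (P.mu * max b1 b2)

/-- `τ_{k+1} = τ_k / √(1 + ρ_{k+1} τ_k)`. -/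
def nextTau (k : ℕ) (st : State d) : ℝ := st.tau / √(1 + P.nextRho k st * st.tau)

/-- `ρ̂_{k+1}`. -/
def nextRhoHat (k : ℕ) (st : State d) : ℝ :=
  if k = 0 then 3 * √(P.nextRho k st / P.tauBar)
  else 1 / ((k : ℝ) + 1) * √(st.rhoHat ^ 2 * (k : ℝ) ^ 2 + 3 * P.nextRho k st * st.rhoHat * k)

/-- Iteration `k` of an epoch. The weight is `t_k = σ_k / σ_0`. -/
def step (k : ℕ) (st : State d) : State d where
  xPrev := st.x
  x := P.nextX st
  xBar := (st.T + st.sigma / P.sigmaBar)⁻¹ •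
    (st.T • st.xBar + (st.sigma / P.sigmaBar) • P.nextX st)
  y := P.nextY st
  sigmaPrev := st.sigma
  sigma := st.sigma * st.tau / P.nextTau k st
  tauPrev := st.tau
  tau := P.nextTau k st
  T := st.T + st.sigma / P.sigmaBar
  rho := P.nextRho k st
  rhoHat := P.nextRhoHat k st

/-- The state with which an epoch starts (`x_{-1} = x_0`, `σ_{-1} = σ_0`, `τ_{-1} = τ_0`). -/
def initState (e : EpochInput d) : State d where
  xPrev := e.x
  x := e.x
  xBar := e.x
  y := e.y
  sigmaPrev := P.sigmaBar
  sigma := P.sigmaBar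
  tauPrev := P.tauBar
  tau := P.tauBar
  T := 0
  rho := e.rho
  rhoHat := 1

/-- The states of an epoch, continued indefinitely. -/
def run (e : EpochInput d) : ℕ → State d
  | 0 => P.initState e
  | k + 1 => P.step k (run e k)

/-- The iteration number that epoch `s` prescribes to itself for a given `ρ̂`. -/
def target (s : ℕ) (rhoHat : ℝ) : ℕ :=
  ⌈max (6 * (rhoHat * P.tauBar)⁻¹)
    (√2 ^ s * (3 * √2 * P.DY / (rhoHat * P.DX * √(P.tauBar * P.sigmaBar))))⌉₊

/-- Epoch `s` stops after `k` iterations as soon as this holds for some `k ≥ 1`. -/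
def Stops (s : ℕ) (e : EpochInput d) (k : ℕ) : Prop :=
  1 ≤ k ∧ P.target s (P.run e k).rhoHat ≤ k

/-- The number of iterations of epoch `s`. -/
def length (s : ℕ) (e : EpochInput d) : ℕ := sInf {k | P.Stops s e k}

/-- The input of epoch `s`. -/
def start : ℕ → EpochInput d
  | 0 => ⟨P.xInit, P.yInit, P.rhoInit⟩
  | s + 1 =>
    let st := P.run (start s) (P.length s (start s))
    ⟨st.x, st.y, st.rho⟩

/-- The number `N_s` of iterations of epoch `s`. -/
def N (s : ℕ) : ℕ := P.length s (P.start s)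

/-- The primal iterate `x_k^s`. -/
def iterX (s k : ℕ) : BlockSpace d := (P.run (P.start s) k).x

end Data

end RAPDPro

end

/-! If block `i` of `x_{k+1}` is nonzero, optimality of the proximal step near `x*` gives a
subgradient of `f` whose block `i` has norm at least `p i`. That subgradient differs little from
`-y* ∇g(x*)` once `x_k`, `x_{k+1}`, `y_{k+1}` are close to the KKT pair and `(x_{k+1} - x_k) / τ_k`
is small. On zero blocks of `x*`, non-degeneracy makes `y* ∇g(x*)` strictly shorter than `p i`, a
contradiction (`exists_identification`).

Closeness is measured by `energy`, which does not increase within an epoch (`energy_step`) as long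
as `ρ_k ≤ μ y*`. The two facts are proved together in `run_invariant`, since the energy bound is
what makes `h1` and `h2` lower bounds for `y*`. As `1 / τ_k` grows at most linearly, each decrease
dominates `c / (k + 1)` times the squares of `‖x_{k+1} - x*‖ / τ_k` and `‖x_{k+1} - x_k‖ / τ_k`
(`energy_decrease_scaled`). The harmonic series diverges, so both are small at some `k` below a
bound independent of the epoch's input. Because `f(x*) > 0`, stationarity then makes the dual error
small too, so the whole energy becomes small and remains so (`exists_energy_le`).

Since `ρ̂_k` is bounded, epoch lengths grow at least like `√2 ^ s`, and a restart costs at most a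
factor `1 / (1 - δ)`. Hence the energy is small throughout all late epochs
(`exists_forall_energy_le`). -/

section

open Filter Topology Set

namespace RAPDPro

/-! ### Convex analysis: proximal steps, strong convexity, gradients and subgradients. -/

section ConvexAnalysis

variable {E : Type*} [NormedAddCommGroup E] [InnerProductSpace ℝ E]

/-- Convexity on a segment, divided by `t`, leaves an error proportional to `t`; letting `t`
decrease to `0` removes it. -/
theorem le_of_forall_sub_mul_le {A C D : ℝ} (h : ∀ t : ℝ, 0 < t → t < 1 → A - t * C ≤ D) :
    A ≤ D := by
  have h1 : Tendsto (fun t : ℝ => A - t * C) (𝓝[>] 0) (𝓝 A) := by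
    have : Tendsto (fun t : ℝ => A - t * C) (𝓝 0) (𝓝 (A - 0 * C)) :=
      Continuous.tendsto (by fun_prop) 0
    simpa using this.mono_left nhdsWithin_le_nhds
  refine le_of_tendsto h1 ?_
  filter_upwards [Ioo_mem_nhdsGT (zero_lt_one' ℝ)] with t ht using h t ht.1 ht.2

/-- Three-point inequality for a proximal step. -/
theorem prox_three_point {S : Set E} {F : E → ℝ} (hF : ConvexOn ℝ S F) {c : ℝ}
    {u a : E} (ha : a ∈ S) (hmin : ∀ z ∈ S, F a + c * ‖a - u‖ ^ 2 ≤ F z + c * ‖z - u‖ ^ 2)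
    {z : E} (hz : z ∈ S) :
    F a + c * ‖a - u‖ ^ 2 + c * ‖z - a‖ ^ 2 ≤ F z + c * ‖z - u‖ ^ 2 := by
  refine le_of_forall_sub_mul_le (C := c * ‖z - a‖ ^ 2) fun t ht0 ht1 => ?_
  have hmem : (1 - t) • a + t • z ∈ S :=
    hF.1 ha hz (by linarith) ht0.le (by ring)
  have h1 := hmin _ hmem
  have h2 := hF.2 ha hz (by linarith : (0 : ℝ) ≤ 1 - t) ht0.le (by ring)
  -- The quadratic lies below its chord by exactly `t * (1 - t) * ‖z - a‖ ^ 2`, which is the source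
  -- of the third term.
  have h3 : ‖(1 - t) • a + t • z - u‖ ^ 2
      = (1 - t) * ‖a - u‖ ^ 2 + t * ‖z - u‖ ^ 2 - t * (1 - t) * ‖z - a‖ ^ 2 := by
    have e1 : (1 - t) • a + t • z - u = (a - u) + t • (z - a) := by module
    have e2 : z - u = (a - u) + (z - a) := by abel
    rw [e1, e2, norm_add_sq_real, norm_add_sq_real, norm_smul, inner_smul_right, mul_pow,
      Real.norm_eq_abs, sq_abs]
    ring
  rw [h3] at h1
  simp only [smul_eq_mul] at h2
  have h4 : t * (F a + c * ‖a - u‖ ^ 2 + c * ‖z - a‖ ^ 2 - t * (c * ‖z - a‖ ^ 2))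
      ≤ t * (F z + c * ‖z - u‖ ^ 2) := by linarith
  exact le_of_mul_le_mul_left h4 ht0

/-- Expanding `‖z - u‖ ^ 2` around `a` cancels all quadratic terms of the three-point inequality. -/
theorem prox_variational {S : Set E} {F : E → ℝ} (hF : ConvexOn ℝ S F) {c : ℝ}
    {u a : E} (ha : a ∈ S) (hmin : ∀ z ∈ S, F a + c * ‖a - u‖ ^ 2 ≤ F z + c * ‖z - u‖ ^ 2)
    {z : E} (hz : z ∈ S) : F a ≤ F z + 2 * c * inner ℝ (a - u) (z - a) := by
  have h := prox_three_point hF ha hmin hz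
  have e2 : z - u = (a - u) + (z - a) := by abel
  rw [e2, norm_add_sq_real] at h
  linarith

/-- A first-order condition that holds near an interior point holds everywhere. -/
theorem neg_mem_subdifferential {S : Set E} {F : E → ℝ} (hF : ConvexOn ℝ univ F) {a w : E}
    (ha : S ∈ 𝓝 a) (h : ∀ z ∈ S, F a ≤ F z + inner ℝ w (z - a)) :
    -w ∈ subdifferential F a := by
  have hlin : ConvexOn ℝ univ fun z => inner ℝ w z := (innerₛₗ ℝ w).convexOn convex_univ
  have hconv : ConvexOn ℝ univ fun z => F z + inner ℝ w z := hF.add hlin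
  have hloc : IsLocalMin (fun z => F z + inner ℝ w z) a := by
    filter_upwards [ha] with z hz
    have := h z hz
    rw [inner_sub_right] at this
    linarith
  intro z
  have := IsMinOn.of_isLocalMin_of_convex_univ hloc hconv z
  simp only [inner_neg_left, inner_sub_right] at this ⊢
  linarith

theorem sq_norm_sub_le_of_strongConvexOn {g : E → ℝ} {m : ℝ} (hg : StrongConvexOn univ m g)
    {x : E} (hx : ∀ z, g x ≤ g z) (z : E) : g x + m / 2 * ‖z - x‖ ^ 2 ≤ g z := by
  refine le_of_forall_sub_mul_le (C := m / 2 * ‖z - x‖ ^ 2) fun t ht0 ht1 => ?_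
  have h3 := hg.2 (mem_univ x) (mem_univ z) (by linarith : (0 : ℝ) ≤ 1 - t) ht0.le (by ring)
  have h4 := hx ((1 - t) • x + t • z)
  rw [norm_sub_rev] at h3
  simp only [smul_eq_mul] at h3
  refine le_of_mul_le_mul_left ?_ ht0
  linarith

variable [CompleteSpace E]

theorem tendsto_slope_gradient {g : E → ℝ} {x : E} (hg : DifferentiableAt ℝ g x) (v : E) :
    Tendsto (fun t : ℝ => t⁻¹ * (g (x + t • v) - g x)) (𝓝[>] 0) (𝓝 (inner ℝ (gradient g x) v)) := by
  have h1 : HasFDerivAt g (InnerProductSpace.toDual ℝ E (gradient g x)) x :=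
    hg.hasGradientAt.hasFDerivAt
  have h2 : HasLineDerivAt ℝ g (InnerProductSpace.toDual ℝ E (gradient g x) v) x v :=
    h1.hasLineDerivAt v
  have := h2.tendsto_slope_zero_right
  simpa using this

theorem hasDerivAt_line {g : E → ℝ} {x v : E} {t : ℝ} (hg : DifferentiableAt ℝ g (x + t • v)) :
    HasDerivAt (fun s : ℝ => g (x + s • v)) (inner ℝ (gradient g (x + t • v)) v) t := by
  have h1 : HasFDerivAt g (InnerProductSpace.toDual ℝ E (gradient g (x + t • v))) (x + t • v) :=
    hg.hasGradientAt.hasFDerivAt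
  have h2 : HasDerivAt (fun s : ℝ => x + s • v) v t := by
    simpa using ((hasDerivAt_id t).smul_const v).const_add x
  simpa [Function.comp_def] using h1.comp_hasDerivAt t h2

theorem gradient_add_le_of_strongConvexOn {g : E → ℝ} {m : ℝ} (hg : StrongConvexOn univ m g)
    {x : E} (hx : DifferentiableAt ℝ g x) (z : E) :
    g x + inner ℝ (gradient g x) (z - x) + m / 2 * ‖z - x‖ ^ 2 ≤ g z := by
  have h1 : Tendsto (fun t : ℝ => t⁻¹ * (g (x + t • (z - x)) - g x)
      + (1 - t) * (m / 2 * ‖z - x‖ ^ 2)) (𝓝[>] 0)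
      (𝓝 (inner ℝ (gradient g x) (z - x) + (1 - 0) * (m / 2 * ‖z - x‖ ^ 2))) := by
    refine (tendsto_slope_gradient hx _).add ?_
    exact (Continuous.tendsto (by fun_prop) 0).mono_left nhdsWithin_le_nhds
  have h2 : inner ℝ (gradient g x) (z - x) + (1 - 0) * (m / 2 * ‖z - x‖ ^ 2) ≤ g z - g x := by
    refine le_of_tendsto h1 ?_
    filter_upwards [Ioo_mem_nhdsGT (zero_lt_one' ℝ)] with t ht
    have h3 := hg.2 (mem_univ x) (mem_univ z) (by linarith [ht.2] : (0 : ℝ) ≤ 1 - t) ht.1.le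
      (by ring)
    have e : (1 - t) • x + t • z = x + t • (z - x) := by module
    rw [e, norm_sub_rev] at h3
    simp only [smul_eq_mul] at h3
    have ht0 : t ≠ 0 := ht.1.ne'
    have h4 : g (x + t • (z - x)) - g x ≤ t * (g z - g x - (1 - t) * (m / 2 * ‖z - x‖ ^ 2)) := by
      linarith
    have h5 := mul_le_mul_of_nonneg_left h4 (inv_nonneg.2 ht.1.le)
    rw [inv_mul_cancel_left₀ ht0] at h5
    linarith
  linarith

theorem le_of_lipschitz_gradient {g : E → ℝ} {S : Set E} (hS : Convex ℝ S) {L : ℝ}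
    (hd : ∀ x ∈ S, DifferentiableAt ℝ g x)
    (hL : ∀ x ∈ S, ∀ x' ∈ S, ‖gradient g x - gradient g x'‖ ≤ L * ‖x - x'‖)
    {x z : E} (hx : x ∈ S) (hz : z ∈ S) :
    g z ≤ g x + inner ℝ (gradient g x) (z - x) + L / 2 * ‖z - x‖ ^ 2 := by
  set v := z - x with hv
  have hmem : ∀ t ∈ Icc (0 : ℝ) 1, x + t • v ∈ S := fun t ht => by
    have := hS hx hz (by linarith [ht.2] : (0 : ℝ) ≤ 1 - t) ht.1 (by ring)
    convert this using 1
    rw [hv]; module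
  -- The claim is `φ 1 ≤ φ 0`. The Lipschitz bound at distance `t * ‖v‖` from `x` gives a
  -- nonpositive derivative, and only points of the segment, hence of `S`, are involved.
  let φ : ℝ → ℝ := fun t => g (x + t • v) - t * inner ℝ (gradient g x) v - L / 2 * ‖v‖ ^ 2 * t ^ 2
  have hφ : ∀ t ∈ Icc (0 : ℝ) 1, HasDerivAt φ (inner ℝ (gradient g (x + t • v)) v
      - inner ℝ (gradient g x) v - L * ‖v‖ ^ 2 * t) t := fun t ht => by
    have h1 := hasDerivAt_line (hd _ (hmem t ht))
    have h2 := (hasDerivAt_id t).mul_const (inner ℝ (gradient g x) v)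
    have h3 := (hasDerivAt_pow 2 t).const_mul (L / 2 * ‖v‖ ^ 2)
    refine ((h1.sub h2).sub h3).congr_deriv ?_
    push_cast
    ring
  have hanti : AntitoneOn φ (Icc 0 1) := by
    refine antitoneOn_of_deriv_nonpos (convex_Icc 0 1)
      (fun t ht => (hφ t ht).continuousAt.continuousWithinAt)
      (fun t ht => (hφ t (interior_subset ht)).differentiableAt.differentiableWithinAt) ?_
    intro t ht
    have ht' := interior_subset ht
    rw [(hφ t ht').deriv, ← inner_sub_left]
    have h1 := real_inner_le_norm (gradient g (x + t • v) - gradient g x) v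
    have h2 := hL _ (hmem t ht') x hx
    rw [add_sub_cancel_left, norm_smul, Real.norm_of_nonneg ht'.1] at h2
    have h3 := mul_le_mul_of_nonneg_right h2 (norm_nonneg v)
    linarith
  have h01 := hanti (left_mem_Icc.2 zero_le_one) (right_mem_Icc.2 zero_le_one) zero_le_one
  simp only [φ, one_smul, zero_smul, add_zero, hv, add_sub_cancel] at h01
  linarith

/-- Subgradients of a sum with a differentiable function. -/
theorem sub_mem_subdifferential {F g : E → ℝ} (hF : ConvexOn ℝ univ F) {y : ℝ} {x w : E}
    (hx : DifferentiableAt ℝ g x) (hw : w ∈ subdifferential (fun z => lagrangian F g z y) x) :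
    w - y • gradient g x ∈ subdifferential F x := by
  intro z
  -- On the segment `F` lies below its chord while `w` bounds the Lagrangian from below; the
  -- difference quotient of `g` is what remains. Convexity of `g` plays no role.
  have h1 : Tendsto (fun t : ℝ => inner ℝ w (z - x) - y * (t⁻¹ * (g (x + t • (z - x)) - g x)))
      (𝓝[>] 0) (𝓝 (inner ℝ w (z - x) - y * inner ℝ (gradient g x) (z - x))) :=
    tendsto_const_nhds.sub ((tendsto_slope_gradient hx _).const_mul y)
  have h2 : inner ℝ w (z - x) - y * inner ℝ (gradient g x) (z - x) ≤ F z - F x := by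
    refine le_of_tendsto h1 ?_
    filter_upwards [Ioo_mem_nhdsGT (zero_lt_one' ℝ)] with t ht
    have h3 := hF.2 (mem_univ x) (mem_univ z) (by linarith [ht.2] : (0 : ℝ) ≤ 1 - t) ht.1.le
      (by ring)
    have e : (1 - t) • x + t • z = x + t • (z - x) := by module
    rw [e] at h3
    have h4 := hw (x + t • (z - x))
    simp only [lagrangian, smul_eq_mul, add_sub_cancel_left, inner_smul_right] at h3 h4
    have ht0 : t ≠ 0 := ht.1.ne'
    have h5 : t * inner ℝ w (z - x) - y * (g (x + t • (z - x)) - g x) ≤ t * (F z - F x) := by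
      linarith
    have h6 := mul_le_mul_of_nonneg_left h5 (inv_nonneg.2 ht.1.le)
    rw [inv_mul_cancel_left₀ ht0, mul_sub, inv_mul_cancel_left₀ ht0] at h6
    linarith
  rw [inner_sub_left, inner_smul_left]
  simp only [conj_trivial]
  linarith

theorem add_mem_subdifferential_lagrangian {F g : E → ℝ} {m : ℝ} (hm : 0 ≤ m)
    (hg : StrongConvexOn univ m g) {y : ℝ} (hy : 0 ≤ y) {x w : E} (hx : DifferentiableAt ℝ g x)
    (hw : w ∈ subdifferential F x) :
    w + y • gradient g x ∈ subdifferential (fun z => lagrangian F g z y) x := by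
  intro z
  have h1 := hw z
  have h2 := gradient_add_le_of_strongConvexOn hg hx z
  have h3 : g x + inner ℝ (gradient g x) (z - x) ≤ g z := by
    have : 0 ≤ m / 2 * ‖z - x‖ ^ 2 := by positivity
    linarith
  have h4 := mul_le_mul_of_nonneg_left h3 hy
  simp only [lagrangian, inner_add_left, inner_smul_left, conj_trivial]
  linarith

end ConvexAnalysis

/-- The line through `w` and `0` stays in the affine span, so a relatively interior `0` allows the
segment from `w` to be prolonged slightly beyond `0`. -/
theorem exists_neg_smul_mem_of_mem_intrinsicInterior {E : Type*} [NormedAddCommGroup E] [NormedSpace ℝ E] {S : Set E}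
    (h0 : (0 : E) ∈ intrinsicInterior ℝ S) {w : E} (hw : w ∈ S) :
    ∃ t : ℝ, 0 < t ∧ -(t • w) ∈ S := by
  obtain ⟨a, ha, ha0⟩ := mem_intrinsicInterior.1 h0
  have hS0 : (0 : E) ∈ S := intrinsicInterior_subset h0
  have h0s : (0 : E) ∈ affineSpan ℝ S := subset_affineSpan ℝ S hS0
  have hws : w ∈ affineSpan ℝ S := subset_affineSpan ℝ S hw
  have hmem : ∀ t : ℝ, -(t • w) ∈ affineSpan ℝ S := fun t => by
    have := AffineMap.lineMap_mem (-t) h0s hws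
    simpa [AffineMap.lineMap_apply] using this
  let γ : ℝ → affineSpan ℝ S := fun t => ⟨-(t • w), hmem t⟩
  have hγ : Continuous γ := by
    refine Continuous.subtype_mk ?_ _
    fun_prop
  have hγ0 : γ 0 = a := by
    apply Subtype.ext; simp [γ, ha0]
  have : ∀ᶠ t in 𝓝 (0 : ℝ), γ t ∈ ((↑) ⁻¹' S : Set (affineSpan ℝ S)) := by
    apply hγ.continuousAt.eventually_mem
    rw [hγ0]
    exact mem_interior_iff_mem_nhds.1 ha
  have h2 : ∀ᶠ t in 𝓝[>] (0 : ℝ), γ t ∈ ((↑) ⁻¹' S : Set (affineSpan ℝ S)) :=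
    nhdsWithin_le_nhds this
  obtain ⟨t, ht1, ht2⟩ := (h2.and self_mem_nhdsWithin).exists
  exact ⟨t, ht2, ht1⟩

/-! ### The subdifferential of a weighted norm away from the origin. -/

section NormSubdifferential

variable {E : Type*} [NormedAddCommGroup E] [InnerProductSpace ℝ E]

theorem subdifferential_mul_norm_of_ne_zero {p : ℝ} (hp : 0 < p) {x : E} (hx : x ≠ 0) :
    subdifferential (fun u : E => p * ‖u‖) x = {(p / ‖x‖) • x} := by
  have hx' : 0 < ‖x‖ := norm_pos_iff.2 hx
  ext v
  rw [mem_singleton_iff]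
  constructor
  · intro hv
    -- The test points `0` and `x + v` yield `p * ‖x‖ ≤ ⟪v, x⟫` and `‖v‖ ≤ p`, the equality case of
    -- Cauchy–Schwarz.
    have h1 := hv 0
    have h2 := hv (x + v)
    simp only [norm_zero, mul_zero, zero_sub, inner_neg_right, add_sub_cancel_left,
      real_inner_self_eq_norm_sq] at h1 h2
    have h3 := mul_le_mul_of_nonneg_left (norm_add_le x v) hp.le
    have h4 : ‖v‖ ≤ p := by
      by_contra! h
      nlinarith [norm_nonneg v]
    have h5 : ‖v - (p / ‖x‖) • x‖ ^ 2 ≤ 0 := by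
      rw [norm_sub_sq_real, norm_smul, inner_smul_right, Real.norm_of_nonneg (by positivity),
        div_mul_cancel₀ _ hx'.ne']
      have h6 : p / ‖x‖ * (p * ‖x‖) ≤ p / ‖x‖ * inner ℝ v x :=
        mul_le_mul_of_nonneg_left (by linarith) (by positivity)
      have h7 : p / ‖x‖ * (p * ‖x‖) = p ^ 2 := by field_simp
      have h8 : ‖v‖ ^ 2 ≤ p ^ 2 := by gcongr
      linarith
    exact sub_eq_zero.1 (norm_eq_zero.1 (pow_eq_zero_iff two_ne_zero |>.1
      (le_antisymm h5 (sq_nonneg _))))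
  · rintro rfl z
    simp only [inner_smul_left, conj_trivial, inner_sub_right, real_inner_self_eq_norm_sq]
    have h1 := mul_le_mul_of_nonneg_left (real_inner_le_norm x z)
      (by positivity : 0 ≤ p / ‖x‖)
    have h2 : p / ‖x‖ * (‖x‖ * ‖z‖) = p * ‖z‖ := by field_simp
    have h3 : p / ‖x‖ * ‖x‖ ^ 2 = p * ‖x‖ := by field_simp
    linarith

end NormSubdifferential

/-! ### The group Lasso: blockwise subgradients and strict complementarity. -/

section GroupLasso

variable {B : ℕ} {d : Fin B → ℕ} {p : Fin B → ℝ}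

/-- The vector with block `i` equal to `u` and all other blocks zero. -/
def blockSingle (i : Fin B) (u : EuclideanSpace ℝ (Fin (d i))) : BlockSpace d :=
  WithLp.toLp 2 (Pi.single i u)

theorem blockSingle_same (i : Fin B) (u : EuclideanSpace ℝ (Fin (d i))) :
    (blockSingle i u : BlockSpace d) i = u := by
  simp [blockSingle]

theorem blockSingle_ne {i j : Fin B} (h : j ≠ i) (u : EuclideanSpace ℝ (Fin (d i))) :
    (blockSingle i u : BlockSpace d) j = 0 := by
  simp [blockSingle, h]

theorem inner_blockSingle (v : BlockSpace d) (i : Fin B) (u : EuclideanSpace ℝ (Fin (d i))) :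
    inner ℝ v (blockSingle i u) = inner ℝ (v i) u := by
  rw [PiLp.inner_apply, Finset.sum_eq_single i]
  · rw [blockSingle_same]
  · intro j _ hj
    rw [blockSingle_ne hj, inner_zero_right]
  · simp

theorem groupLasso_nonneg (hp : ∀ i, 0 < p i) (x : BlockSpace d) : 0 ≤ groupLasso p x :=
  Finset.sum_nonneg fun i _ => mul_nonneg (hp i).le (norm_nonneg _)

theorem groupLasso_zero : groupLasso p (0 : BlockSpace d) = 0 := by
  simp [groupLasso]

theorem groupLasso_pos (hp : ∀ i, 0 < p i) {x : BlockSpace d} (hx : x ≠ 0) :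
    0 < groupLasso p x := by
  refine (groupLasso_nonneg hp x).lt_of_ne' fun h => hx ?_
  rw [groupLasso, Finset.sum_eq_zero_iff_of_nonneg
    fun i _ => mul_nonneg (hp i).le (norm_nonneg _)] at h
  ext1 i
  have := h i (Finset.mem_univ i)
  simpa [(hp i).ne'] using this

theorem groupLasso_smul {c : ℝ} (hc : 0 ≤ c) (x : BlockSpace d) :
    groupLasso p (c • x) = c * groupLasso p x := by
  simp only [groupLasso, Finset.mul_sum, PiLp.smul_apply, norm_smul, Real.norm_of_nonneg hc]
  exact Finset.sum_congr rfl fun i _ => by ring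

theorem groupLasso_add_le (hp : ∀ i, 0 < p i) (x z : BlockSpace d) :
    groupLasso p (x + z) ≤ groupLasso p x + groupLasso p z := by
  simp only [groupLasso, ← Finset.sum_add_distrib, ← mul_add]
  exact Finset.sum_le_sum fun i _ => mul_le_mul_of_nonneg_left (norm_add_le _ _) (hp i).le

theorem convexOn_groupLasso (hp : ∀ i, 0 < p i) :
    ConvexOn ℝ univ (groupLasso p : BlockSpace d → ℝ) := by
  refine ⟨convex_univ, fun x _ z _ a b ha hb _ => ?_⟩
  have := groupLasso_add_le hp (a • x) (b • z)
  rwa [groupLasso_smul ha, groupLasso_smul hb] at this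

theorem groupLasso_le_mul_norm (hp : ∀ i, 0 < p i) (x : BlockSpace d) :
    groupLasso p x ≤ (∑ i, p i) * ‖x‖ := by
  rw [groupLasso, Finset.sum_mul]
  exact Finset.sum_le_sum fun i _ => mul_le_mul_of_nonneg_left (PiLp.norm_apply_le x i) (hp i).le

theorem groupLasso_sub_le (hp : ∀ i, 0 < p i) (x z : BlockSpace d) :
    groupLasso p x - groupLasso p z ≤ (∑ i, p i) * ‖x - z‖ := by
  have h1 := groupLasso_add_le hp z (x - z)
  rw [add_sub_cancel] at h1
  linarith [groupLasso_le_mul_norm hp (x - z)]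

theorem abs_groupLasso_sub_le (hp : ∀ i, 0 < p i) (x z : BlockSpace d) :
    |groupLasso p x - groupLasso p z| ≤ (∑ i, p i) * ‖x - z‖ := by
  rw [abs_le]
  have h1 := groupLasso_sub_le hp x z
  have h2 := groupLasso_sub_le hp z x
  rw [norm_sub_rev] at h2
  constructor <;> linarith

theorem continuous_groupLasso : Continuous (groupLasso p : BlockSpace d → ℝ) := by
  unfold groupLasso
  fun_prop

theorem groupLasso_sub_blockSingle (x : BlockSpace d) (i : Fin B) :
    groupLasso p (x - blockSingle i (x i)) = groupLasso p x - p i * ‖x i‖ := by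
  rw [eq_sub_iff_add_eq, ← eq_sub_iff_add_eq', groupLasso, groupLasso, ← Finset.sum_sub_distrib,
    Finset.sum_eq_single i]
  · simp [blockSingle_same]
  · intro j _ hj
    simp [blockSingle_ne hj]
  · simp

theorem groupLasso_add_blockSingle {x : BlockSpace d} {i : Fin B} (hx : x i = 0)
    (u : EuclideanSpace ℝ (Fin (d i))) :
    groupLasso p (x + blockSingle i u) = groupLasso p x + p i * ‖u‖ := by
  have h := groupLasso_sub_blockSingle (p := p) (x + blockSingle i u) i
  rw [PiLp.add_apply, hx, zero_add, blockSingle_same, add_sub_cancel_right] at h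
  linarith

variable {x v : BlockSpace d}

/-- Euler's identity for a positively homogeneous function, squeezed out of the test points `0` and
`2 • x`. -/
theorem groupLasso_eq_inner (hv : v ∈ subdifferential (groupLasso p) x) :
    groupLasso p x = inner ℝ v x := by
  have h1 := hv 0
  have h2 := hv ((2 : ℝ) • x)
  rw [groupLasso_zero, zero_sub, inner_neg_right] at h1
  rw [groupLasso_smul zero_le_two, two_smul, add_sub_cancel_right] at h2
  linarith

/-- The identification criterion, used in contrapositive form. The test point is `x` with block `i`
deleted. -/
theorem le_norm_of_mem_subdifferential (hv : v ∈ subdifferential (groupLasso p) x) {i : Fin B}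
    (hx : x i ≠ 0) : p i ≤ ‖v i‖ := by
  have h := hv (x - blockSingle i (x i))
  rw [groupLasso_sub_blockSingle, sub_sub_cancel_left, inner_neg_right, inner_blockSingle] at h
  have h2 := real_inner_le_norm (v i) (x i)
  exact le_of_mul_le_mul_right (by linarith : p i * ‖x i‖ ≤ ‖v i‖ * ‖x i‖) (norm_pos_iff.2 hx)

theorem norm_le_of_mem_subdifferential (hp : ∀ i, 0 < p i)
    (hv : v ∈ subdifferential (groupLasso p) x) {i : Fin B} (hx : x i = 0) : ‖v i‖ ≤ p i := by
  have h := hv (x + blockSingle i (v i))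
  rw [groupLasso_add_blockSingle hx, add_sub_cancel_left, inner_blockSingle,
    real_inner_self_eq_norm_sq] at h
  by_contra! hlt
  nlinarith [hp i]

/-- Blocks of a subgradient vary independently of each other. This supplies the second subgradient
needed to exploit the relative interior. -/
theorem add_blockSingle_mem_subdifferential (hv : v ∈ subdifferential (groupLasso p) x)
    {i : Fin B} (hx : x i = 0) {u : EuclideanSpace ℝ (Fin (d i))} (hu : ‖u‖ ≤ p i) :
    v + blockSingle i (u - v i) ∈ subdifferential (groupLasso p) x := by
  intro z
  have h := hv (z - blockSingle i (z i))
  rw [groupLasso_sub_blockSingle, sub_right_comm, inner_sub_right, inner_blockSingle] at h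
  have h1 : inner ℝ (blockSingle i (u - v i)) (z - x)
      = inner ℝ u (z i) - inner ℝ (v i) (z i) := by
    rw [real_inner_comm, inner_blockSingle, real_inner_comm, PiLp.sub_apply, hx, sub_zero,
      inner_sub_left]
  have h2 := real_inner_le_norm u (z i)
  have h3 := mul_le_mul_of_nonneg_right hu (norm_nonneg (z i))
  rw [inner_add_left, h1]
  linarith

theorem eq_zero_of_mem_activeSet (hp : ∀ i, 0 < p i) {i : Fin B} (hi : i ∈ activeSet p x) :
    x i = 0 := by
  by_contra h
  exact hi ⟨_, subdifferential_mul_norm_of_ne_zero (hp i) h⟩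

/-- Non-degeneracy is strict complementarity on the zero blocks. -/
theorem norm_lt_of_isNondegenerate (hp : ∀ i, 0 < p i) {g : BlockSpace d → ℝ} {m : ℝ} (hm : 0 ≤ m)
    (hg : StrongConvexOn univ m g) (hx : DifferentiableAt ℝ g x) {y : ℝ} (hy : 0 ≤ y)
    (h : IsNondegenerate (groupLasso p) g x y) {i : Fin B} (hi : x i = 0) :
    ‖(y • gradient g x) i‖ < p i := by
  have h0 := intrinsicInterior_subset h
  have hsub := sub_mem_subdifferential (convexOn_groupLasso hp) hx h0
  set v := y • gradient g x with hv
  rw [zero_sub] at hsub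
  have hle := norm_le_of_mem_subdifferential hp hsub hi
  rw [PiLp.neg_apply, norm_neg] at hle
  -- Block `i` of the subgradient `-v` is flipped to `v i`, so that the Lagrangian has a subgradient
  -- supported on block `i` with value `2 • v i`. Prolonging through `0` produces a subgradient of
  -- the regularizer with block `-((1 + 2 * t) • v i)`, too long if `‖v i‖ = p i`.
  have h1 := add_blockSingle_mem_subdifferential hsub hi hle
  have h2 := add_mem_subdifferential_lagrangian hm hg hy hx h1
  obtain ⟨t, ht, hmem⟩ := exists_neg_smul_mem_of_mem_intrinsicInterior h h2
  have h3 := norm_le_of_mem_subdifferential hp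
    (sub_mem_subdifferential (convexOn_groupLasso hp) hx hmem) hi
  rw [← hv] at h3
  have e : (-(t • (-v + blockSingle i (v i - (-v) i) + v)) - v) i = -((1 + 2 * t) • v i) := by
    simp only [PiLp.sub_apply, PiLp.neg_apply, PiLp.smul_apply, PiLp.add_apply, blockSingle_same]
    module
  rw [e, norm_neg, norm_smul, Real.norm_of_nonneg (by positivity)] at h3
  by_contra! hlt
  nlinarith [hp i]

end GroupLasso

/-! ### The KKT pair and the lower bounds `h1`, `h2` for its multiplier. -/

theorem argminOn_spec {α : Type*} [Nonempty α] [TopologicalSpace α] {s : Set α} {φ : α → ℝ}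
    (hs : IsCompact s) (hne : s.Nonempty) (hφ : Continuous φ) :
    argminOn s φ ∈ s ∧ ∀ b ∈ s, φ (argminOn s φ) ≤ φ b := by
  obtain ⟨a, ha, hmin⟩ := hs.exists_isMinOn hne hφ.continuousOn
  exact Classical.epsilon_spec (p := fun a => a ∈ s ∧ ∀ b ∈ s, φ a ≤ φ b)
    ⟨a, ha, fun b hb => hmin hb⟩

/-- The facts about a KKT pair and the algorithm parameters on which the analysis rests. -/
structure KKTSetting {B : ℕ} {d : Fin B → ℕ} (P : Data d) (xs : BlockSpace d) (ys : ℝ) : Prop where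
  p_pos : ∀ i, 0 < P.p i
  mu_pos : 0 < P.mu
  LX_pos : 0 < P.LX
  LG_pos : 0 < P.LG
  sigma_pos : 0 < P.sigmaBar
  nu0_mem : P.nu0 ∈ Ioo (0 : ℝ) 1
  delta_mem : P.delta ∈ Ioo (0 : ℝ) 1
  zeta_pos : 0 < P.zeta
  r_pos : 0 < P.r
  ys_pos : 0 < ys
  ys_le : ys ≤ P.cBar
  ball : ∀ x, ‖x - xs‖ ≤ P.zeta → x ∈ P.X
  g_eq : P.g xs = 0
  f_pos : 0 < P.f xs
  subgradient : -(ys • gradient P.g xs) ∈ subdifferential P.f xs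
  strong : ∀ x ∈ P.X, ∀ z,
    P.g x + inner ℝ (gradient P.g x) (z - x) + P.mu / 2 * ‖z - x‖ ^ 2 ≤ P.g z
  descent : ∀ x ∈ P.X, ∀ z ∈ P.X,
    P.g z ≤ P.g x + inner ℝ (gradient P.g x) (z - x) + P.LX / 2 * ‖z - x‖ ^ 2
  lip : ∀ x ∈ P.X, ∀ z ∈ P.X, |P.g x - P.g z| ≤ P.LG * ‖x - z‖
  lip_gradient : ∀ x ∈ P.X, ∀ z ∈ P.X,
    ‖gradient P.g x - gradient P.g z‖ ≤ P.LX * ‖x - z‖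
  r_le : P.r ≤ ys * ‖gradient P.g xs‖

namespace KKTSetting

variable {B : ℕ} {d : Fin B → ℕ} {P : Data d} {xs : BlockSpace d} {ys : ℝ}
  (h : KKTSetting P xs ys)
include h

theorem xs_mem : xs ∈ P.X := h.ball xs (by simpa using h.zeta_pos.le)

theorem cBar_pos : 0 < P.cBar := h.ys_pos.trans_le h.ys_le

theorem LXY_pos : 0 < P.LXY := mul_pos h.cBar_pos h.LX_pos

theorem tauBar_den_pos : 0 < P.LXY + P.LG ^ 2 * P.sigmaBar / P.delta := by
  have := h.LXY_pos
  have := h.delta_mem.1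
  have := h.sigma_pos
  positivity

theorem tauBar_pos : 0 < P.tauBar :=
  mul_pos (by linarith [h.nu0_mem.2]) (inv_pos.2 h.tauBar_den_pos)

theorem tauBar_mul : P.tauBar * (P.LXY + P.LG ^ 2 * P.sigmaBar / P.delta) = 1 - P.nu0 := by
  rw [Data.tauBar, mul_assoc, inv_mul_cancel₀ h.tauBar_den_pos.ne', mul_one]

theorem norm_sub_le_DX {x : BlockSpace d} (hx : x ∈ P.X) : ‖x - xs‖ ≤ P.DX := by
  rw [← dist_eq_norm]
  exact Metric.dist_le_diam_of_mem Metric.isBounded_closedBall hx h.xs_mem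

theorem xs_ne_zero : xs ≠ 0 := by
  rintro rfl
  have := h.f_pos
  rw [Data.f, groupLasso_zero] at this
  exact this.false

theorem DX_pos : 0 < P.DX := by
  have hx : 0 < ‖xs‖ := norm_pos_iff.2 h.xs_ne_zero
  have h1 : ‖xs + (P.zeta / ‖xs‖) • xs - xs‖ = P.zeta := by
    rw [add_sub_cancel_left, norm_smul, Real.norm_of_nonneg (by have := h.zeta_pos; positivity),
      div_mul_cancel₀ _ hx.ne']
  have h2 := h.norm_sub_le_DX (h.ball _ h1.le)
  linarith [h.zeta_pos]

theorem abs_sub_le_DY {y : ℝ} (hy : |y| ≤ P.cBar) : |y - ys| ≤ P.DY := by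
  rw [← Real.dist_eq]
  refine Metric.dist_le_diam_of_mem ?_ hy ?_
  · refine (Metric.isBounded_Icc (-P.cBar) P.cBar).subset fun y hy => ?_
    exact abs_le.1 hy
  · show |ys| ≤ P.cBar
    rw [abs_of_pos h.ys_pos]
    exact h.ys_le

theorem DY_pos : 0 < P.DY := by
  have := h.abs_sub_le_DY (y := 0) (by simpa using h.cBar_pos.le)
  rw [zero_sub, abs_neg, abs_of_pos h.ys_pos] at this
  linarith [h.ys_pos]

theorem DeltaXY_pos : 0 < P.DeltaXY := by
  have := h.tauBar_pos
  have := h.sigma_pos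
  have := h.DX_pos
  have := h.DY_pos
  unfold Data.DeltaXY
  positivity

/-- The Lagrangian at the multiplier inherits the modulus `ys * P.mu` from `g` and is minimal at
`xs`, where it equals `P.f xs`. -/
theorem lagrangian_gap (x : BlockSpace d) :
    ys * P.mu / 2 * ‖x - xs‖ ^ 2 ≤ P.f x + ys * P.g x - P.f xs := by
  have h1 := h.subgradient x
  have h2 := mul_le_mul_of_nonneg_left (h.strong xs h.xs_mem x) h.ys_pos.le
  rw [h.g_eq] at h2
  rw [inner_neg_left, inner_smul_left] at h1
  simp only [conj_trivial] at h1
  linarith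

/-- Transports `r ≤ ys * ‖∇g(xs)‖` to a point where the gradient can be computed; both dual bounds
start here. -/
theorem r_le_of_mem {x : BlockSpace d} (hx : x ∈ P.X) :
    P.r ≤ ys * (‖gradient P.g x‖ + P.LX * ‖x - xs‖) := by
  refine h.r_le.trans (mul_le_mul_of_nonneg_left ?_ h.ys_pos.le)
  have h1 := h.lip_gradient x hx xs h.xs_mem
  have h2 := norm_sub_norm_le (gradient P.g xs) (gradient P.g x)
  rw [norm_sub_rev] at h2
  linarith

theorem h1_le {x : BlockSpace d} (hx : x ∈ P.X) {β : ℝ} (hβ : ‖x - xs‖ ^ 2 ≤ 2 * β) :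
    P.h1 x β ≤ ys := by
  have h1 := h.r_le_of_mem hx
  have h2 : ‖x - xs‖ ≤ √(2 * β) := Real.le_sqrt_of_sq_le hβ
  have h3 : P.r ≤ ys * (‖gradient P.g x‖ + P.LX * √(2 * β)) := by
    have h4 := mul_le_mul_of_nonneg_left h2 h.LX_pos.le
    have h5 : ys * (‖gradient P.g x‖ + P.LX * ‖x - xs‖)
        ≤ ys * (‖gradient P.g x‖ + P.LX * √(2 * β)) :=
      mul_le_mul_of_nonneg_left (by linarith) h.ys_pos.le
    linarith
  have h6 : 0 < ‖gradient P.g x‖ + P.LX * √(2 * β) := by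
    by_contra! hle
    have := mul_nonpos_of_nonneg_of_nonpos h.ys_pos.le hle
    linarith [h.r_pos]
  rw [Data.h1, ← div_eq_mul_inv, div_le_iff₀ h6]
  exact h3

/-- The distance bound carries the factor `ys`, so `r_le_of_mem` becomes a quadratic inequality in
`s = √ys`, and `h2` is the square of the positive root of the quadratic. -/
theorem h2_le {x : BlockSpace d} (hx : x ∈ P.X) {β : ℝ} (hβ0 : 0 ≤ β)
    (hβ : ys * P.mu * ‖x - xs‖ ^ 2 ≤ 2 * β) : P.h2 x β ≤ ys := by
  have hr := h.r_pos
  have hmu := h.mu_pos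
  have hL := h.LX_pos
  have hys := h.ys_pos
  set w := √(β / (2 * P.mu)) with hw
  set A := P.LX / P.r * w with hA
  set G := ‖gradient P.g x‖ with hG
  have hw2 : w ^ 2 = β / (2 * P.mu) := Real.sq_sqrt (by positivity)
  have hA0 : 0 ≤ A := by positivity
  have hA2 : P.LX ^ 2 * β / (2 * P.mu * P.r ^ 2) = A ^ 2 := by
    rw [hA, mul_pow, hw2]; field_simp
  have hGr : 0 ≤ G / P.r := by positivity
  rw [Data.h2, ← hw, ← hA, ← hG, hA2]
  set b := √(A ^ 2 + G / P.r) with hb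
  have hb2 : b ^ 2 = A ^ 2 + G / P.r := Real.sq_sqrt (by positivity)
  have hb0 : A ≤ b := Real.le_sqrt_of_sq_le (by linarith)
  set s := √ys with hs
  have hs2 : s ^ 2 = ys := Real.sq_sqrt hys.le
  have hs0 : 0 < s := Real.sqrt_pos.2 hys
  set n := ‖x - xs‖ with hn
  have hsn : s * n ≤ 2 * w := by
    refine abs_le_of_sq_le_sq' ?_ (by positivity) |>.2
    rw [mul_pow, mul_pow, hs2, hw2]
    have : (2 : ℝ) ^ 2 * (β / (2 * P.mu)) = 2 * β / P.mu := by field_simp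
    rw [this, le_div_iff₀ hmu]
    linarith
  have h1 := h.r_le_of_mem hx
  rw [← hG, ← hn, ← hs2] at h1
  have h2 : P.r ≤ s ^ 2 * G + s * P.LX * (2 * w) := by
    have := mul_le_mul_of_nonneg_left hsn (by positivity : 0 ≤ s * P.LX)
    linarith
  have h3 : 1 ≤ s ^ 2 * (G / P.r) + 2 * (s * A) := by
    have := div_le_div_of_nonneg_right h2 hr.le
    rw [div_self hr.ne'] at this
    refine this.trans_eq ?_
    rw [hA]; field_simp
  -- Since `G / r = b ^ 2 - A ^ 2`, equality in `h3` holds exactly at `s = 1 / (A + b)` among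
  -- positive `s`.
  have h4 : 1 ≤ s * (A + b) := by
    by_contra! hlt
    have e1 : s ^ 2 * (G / P.r) = (s * (A + b)) ^ 2 - 2 * (s * A) * (s * (A + b)) := by
      have : G / P.r = b ^ 2 - A ^ 2 := by linarith
      rw [this]; ring
    have e2 : 2 * (s * A) ≤ s * (A + b) := by nlinarith
    have e3 : 0 ≤ s * A := by positivity
    nlinarith
  have h5 : 1 ≤ ys * (A + b) ^ 2 := by
    rw [← hs2, ← mul_pow]
    exact one_le_pow₀ h4
  have h6 : 0 < (A + b) ^ 2 := by
    by_contra! hle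
    have := mul_nonpos_of_nonneg_of_nonpos hys.le hle
    linarith
  rw [inv_le_iff_one_le_mul₀ h6]
  exact h5

end KKTSetting

/-! ### One iteration: decrease of the Lyapunov function. -/

/-- Consistency of the variables of an epoch before an iteration. -/
structure State.Valid {B : ℕ} {d : Fin B → ℕ} (P : Data d) (ys : ℝ) (st : State d) : Prop where
  x_mem : st.x ∈ P.X
  xPrev_mem : st.xPrev ∈ P.X
  xBar_mem : st.xBar ∈ P.X
  y_mem : |st.y| ≤ P.cBar
  rho_nonneg : 0 ≤ st.rho
  rho_le : st.rho ≤ ys * P.mu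
  tau_pos : 0 < st.tau
  tau_le : st.tau ≤ st.tauPrev
  tauPrev_le : st.tauPrev ≤ P.tauBar
  sigma_eq : st.sigma = P.sigmaBar * P.tauBar / st.tau
  sigmaPrev_eq : st.sigmaPrev = P.sigmaBar * P.tauBar / st.tauPrev
  -- Times `P.tauBar / 2`, this bounds the coefficient of `‖x_k - x*‖ ^ 2` left by the primal step
  -- by its coefficient in `energy`.
  curvature : (1 - st.rho * st.tau) / st.tau ^ 2 ≤ 1 / st.tauPrev ^ 2
  T_nonneg : 0 ≤ st.T

/-- The Lyapunov function of an epoch. -/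
noncomputable def energy {B : ℕ} {d : Fin B → ℕ} (P : Data d) (xs : BlockSpace d) (ys : ℝ)
    (st : State d) : ℝ :=
  P.tauBar / (2 * st.tauPrev ^ 2) * ‖st.x - xs‖ ^ 2 + 1 / (2 * P.sigmaBar) * (st.y - ys) ^ 2
    - st.sigmaPrev / P.sigmaBar * (ys - st.y) * (P.g st.x - P.g st.xPrev)
    + st.sigmaPrev ^ 2 * P.LG ^ 2 / (2 * P.delta * P.sigmaBar) * ‖st.x - st.xPrev‖ ^ 2

theorem young {a b δ : ℝ} (hδ : 0 < δ) : a * b ≤ δ / 2 * a ^ 2 + 1 / (2 * δ) * b ^ 2 := by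
  have h1 : δ / 2 * a ^ 2 + 1 / (2 * δ) * b ^ 2 - a * b = (δ * a - b) ^ 2 / (2 * δ) := by
    field_simp; ring
  have h2 : 0 ≤ (δ * a - b) ^ 2 / (2 * δ) := by positivity
  linarith

/-- `nextTau` with an arbitrary curvature estimate. -/
theorem div_sqrt_curvature {ρ τ τ' : ℝ} (hρ : 0 ≤ ρ) (hτ : 0 < τ) (h' : τ' = τ / √(1 + ρ * τ)) :
    0 < τ' ∧ τ' ≤ τ ∧ (1 - ρ * τ') / τ' ^ 2 ≤ 1 / τ ^ 2 ∧ 1 / τ' ≤ 1 / τ + ρ / 2 := by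
  have ha : 0 ≤ ρ * τ := by positivity
  set w := √(1 + ρ * τ) with hw
  have hw2 : w ^ 2 = 1 + ρ * τ := Real.sq_sqrt (by positivity)
  have hw1 : 1 ≤ w := by
    rw [hw]; exact Real.one_le_sqrt.2 (by linarith)
  have hw0 : 0 < w := by linarith
  subst h'
  refine ⟨by positivity, div_le_self hτ.le hw1, ?_, ?_⟩
  -- After clearing denominators the claim is `1 + ρ * τ - ρ * τ * w ≤ 1`, true because `w ≥ 1`.
  · have e : (1 - ρ * (τ / w)) / (τ / w) ^ 2 = (w ^ 2 - ρ * τ * w) / τ ^ 2 := by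
      field_simp
    rw [e]
    gcongr
    nlinarith
  · have e : 1 / (τ / w) = w / τ := by field_simp
    have e2 : 1 / τ + ρ / 2 = (1 + ρ * τ / 2) / τ := by field_simp
    rw [e, e2]
    gcongr
    nlinarith

/-- The scalar skeleton of `energy_step`: `hI` is the primal step, `hII` the dual projection, `hIII`
Young's inequality. `X` stands for squared distances to the solution, `D` for squared steps, and
`a`, `b`, `bp` for `g` at `x_{k+1}`, `x_k`, `x_{k-1}`. The extrapolation in `z_k` makes the products
with `a - b` and `b - bp` telescope. -/
theorem energy_algebra {κ σ σp c ρ δ ν m X0 X1 D0 D1 y y' ys a b bp M Q R R' : ℝ}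
    (hα : 0 ≤ σ * κ) (hκ : 0 ≤ κ) (hδ : δ ≤ 1) (hX0 : 0 ≤ X0) (hD1 : 0 ≤ D1)
    (hI : m * X1 + (y' - ys) * a + c * (D1 + X1) ≤ (c - ρ / 2) * X0 + M * D1)
    (hII : (y' - y) ^ 2 + (ys - y') ^ 2
      ≤ (ys - y) ^ 2 - 2 * ((σ + σp) * b - σp * bp) * (ys - y'))
    (hIII : κ * ((y' - y) * (σp * (b - bp))) ≤ δ * (κ / 2) * (y' - y) ^ 2 + R' * D0)
    (hcurv : σ * κ * (c - ρ / 2) ≤ Q)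
    (hV : σ * κ * M + R + ν * (σ * κ * c) ≤ σ * κ * c) :
    σ * κ * (m * X1) + ν * (σ * κ * c) * D1
      + (σ * κ * c * X1 + κ / 2 * (y' - ys) ^ 2 - σ * κ * (ys - y') * (a - b) + R * D1)
    ≤ Q * X0 + κ / 2 * (y - ys) ^ 2 - σp * κ * (ys - y) * (b - bp) + R' * D0 := by
  have h1 := mul_le_mul_of_nonneg_left hI hα
  have h2 := mul_le_mul_of_nonneg_left hII (by positivity : 0 ≤ κ / 2)
  have h3 := mul_le_mul_of_nonneg_right hcurv hX0
  have h4 := mul_le_mul_of_nonneg_right hV hD1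
  have h5 : δ * (κ / 2) * (y' - y) ^ 2 ≤ κ / 2 * (y' - y) ^ 2 :=
    mul_le_mul_of_nonneg_right (mul_le_of_le_one_left (by positivity) hδ) (sq_nonneg _)
  linarith

namespace State.Valid

variable {B : ℕ} {d : Fin B → ℕ} {P : Data d} {xs : BlockSpace d} {ys : ℝ} {st : State d}
  (h : KKTSetting P xs ys) (v : st.Valid P ys)
include h v

omit h in
theorem tauPrev_pos : 0 < st.tauPrev := v.tau_pos.trans_le v.tau_le

theorem sigma_pos : 0 < st.sigma := by
  rw [v.sigma_eq]
  exact div_pos (mul_pos h.sigma_pos h.tauBar_pos) v.tau_pos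

/-- As `ρ_k ≤ ys * μ`, the cut does not remove the multiplier, so the projection inequality may be
tested at `ys`. -/
theorem nextY_spec : (0 ≤ P.nextY st ∧ st.rho ≤ P.nextY st * P.mu ∧ P.nextY st ≤ P.cBar) ∧
    (P.nextY st - st.y) ^ 2 + (ys - P.nextY st) ^ 2 ≤ (ys - st.y) ^ 2
      - 2 * ((st.sigma + st.sigmaPrev) * P.g st.x - st.sigmaPrev * P.g st.xPrev)
        * (ys - P.nextY st) := by
  have hset : P.Ycut st.rho = Icc (max 0 (st.rho / P.mu)) P.cBar := by
    ext y
    simp only [Data.Ycut, Data.Y, mem_inter_iff, mem_ofPred_eq, mem_Icc, max_le_iff,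
      div_le_iff₀ h.mu_pos]
    constructor
    · rintro ⟨⟨h0, h1⟩, h2⟩
      rw [abs_of_nonneg h0] at h1 h2
      exact ⟨⟨h0, h1⟩, h2⟩
    · rintro ⟨⟨h0, h1⟩, h2⟩
      rw [abs_of_nonneg h0]
      exact ⟨⟨h0, h1⟩, h2⟩
  have hys : ys ∈ P.Ycut st.rho := by
    rw [hset, mem_Icc, max_le_iff, div_le_iff₀ h.mu_pos]
    exact ⟨⟨h.ys_pos.le, v.rho_le⟩, h.ys_le⟩
  have hc : IsCompact (P.Ycut st.rho) := by rw [hset]; exact isCompact_Icc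
  have hconv : Convex ℝ (P.Ycut st.rho) := by rw [hset]; exact convex_Icc _ _
  set u := st.y + st.sigma * ((1 + st.sigmaPrev / st.sigma) * P.g st.x
      - st.sigmaPrev / st.sigma * P.g st.xPrev) with hu
  have hu' : u = st.y + ((st.sigma + st.sigmaPrev) * P.g st.x - st.sigmaPrev * P.g st.xPrev) := by
    have := (v.sigma_pos h).ne'
    rw [hu]; field_simp
  obtain ⟨hmem, hmin⟩ := argminOn_spec (φ := fun y : ℝ => ‖y - u‖ ^ 2) hc ⟨ys, hys⟩
    (by fun_prop)
  change P.nextY st ∈ _ at hmem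
  change ∀ b ∈ _, ‖P.nextY st - u‖ ^ 2 ≤ _ at hmin
  have h3 := prox_three_point (F := fun _ : ℝ => (0 : ℝ)) (c := 1) (convexOn_const 0 hconv) hmem
    (fun z hz => by simpa using hmin z hz) hys
  simp only [Real.norm_eq_abs, sq_abs, one_mul, zero_add] at h3
  rw [hset, mem_Icc, max_le_iff, div_le_iff₀ h.mu_pos] at hmem
  refine ⟨⟨hmem.1.1, hmem.1.2, hmem.2⟩, ?_⟩
  rw [hu'] at h3
  linarith

omit v in
theorem nextX_spec (st : State d) : P.nextX st ∈ P.X ∧ ∀ z ∈ P.X,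
    P.f (P.nextX st) + inner ℝ (P.nextY st • gradient P.g st.x) (P.nextX st)
        + 1 / (2 * st.tau) * ‖P.nextX st - st.x‖ ^ 2
      ≤ P.f z + inner ℝ (P.nextY st • gradient P.g st.x) z
        + 1 / (2 * st.tau) * ‖z - st.x‖ ^ 2 := by
  refine argminOn_spec (φ := fun z => P.f z + inner ℝ (P.nextY st • gradient P.g st.x) z
        + 1 / (2 * st.tau) * ‖z - st.x‖ ^ 2) (isCompact_closedBall _ _) ⟨xs, h.xs_mem⟩ ?_
  have : Continuous P.f := continuous_groupLasso
  fun_prop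

omit v in
theorem convexOn_nextX_objective (w : BlockSpace d) :
    ConvexOn ℝ P.X fun z => P.f z + inner ℝ w z :=
  have hX : Convex ℝ P.X := convex_closedBall _ _
  ConvexOn.add ((convexOn_groupLasso h.p_pos).subset (subset_univ P.X) hX)
    ((innerₛₗ ℝ w).convexOn hX)

/-- Strong convexity is used twice: at `st.x`, where the cut `ρ_k ≤ y_{k+1} * μ` turns it into the
gain `ρ_k / 2`, and at `xs` through `lagrangian_gap`. The descent lemma costs `LXY / 2` because
`y_{k+1} ≤ c̄`. -/
theorem primal_step : ys * P.mu / 2 * ‖P.nextX st - xs‖ ^ 2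
      + (P.nextY st - ys) * P.g (P.nextX st)
      + 1 / (2 * st.tau) * (‖P.nextX st - st.x‖ ^ 2 + ‖P.nextX st - xs‖ ^ 2)
    ≤ (1 / (2 * st.tau) - st.rho / 2) * ‖st.x - xs‖ ^ 2
      + P.LXY / 2 * ‖P.nextX st - st.x‖ ^ 2 := by
  obtain ⟨hX, hmin⟩ := nextX_spec h st
  obtain ⟨⟨hy0, hyρ, hyc⟩, -⟩ := v.nextY_spec h
  have h1 := prox_three_point (convexOn_nextX_objective h _) hX hmin h.xs_mem
  have h2 := h.strong st.x v.x_mem xs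
  have h3 := h.descent st.x v.x_mem _ hX
  have h4 := h.lagrangian_gap (P.nextX st)
  rw [h.g_eq, norm_sub_rev] at h2
  simp only [inner_smul_left, conj_trivial, inner_sub_right, norm_sub_rev xs] at h1 h2 h3
  have h5 := mul_le_mul_of_nonneg_left (add_le_add h2 h3) hy0
  have h6 : st.rho / 2 * ‖st.x - xs‖ ^ 2 ≤ P.nextY st * P.mu / 2 * ‖st.x - xs‖ ^ 2 := by
    gcongr
  have h7 : P.nextY st * P.LX / 2 * ‖P.nextX st - st.x‖ ^ 2
      ≤ P.LXY / 2 * ‖P.nextX st - st.x‖ ^ 2 := by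
    have := h.LX_pos
    unfold Data.LXY
    gcongr
  linarith

omit v in
-- Young's inequality with weight `δ`: the bilinear term of `energy` uses up only the fraction `δ`
-- of the dual term, so that `1 - δ` survives in `le_energy`.
theorem cross_le (st : State d) {y : ℝ} {a : ℝ} (ha : |a| ≤ st.sigmaPrev * P.LG * ‖st.x - st.xPrev‖) :
    1 / P.sigmaBar * (y * a) ≤ P.delta / (2 * P.sigmaBar) * y ^ 2
      + st.sigmaPrev ^ 2 * P.LG ^ 2 / (2 * P.delta * P.sigmaBar) * ‖st.x - st.xPrev‖ ^ 2 := by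
  have hS := h.sigma_pos
  have hδ := h.delta_mem.1
  have h1 := young (a := y) (b := a) hδ
  have h2 : a ^ 2 ≤ (st.sigmaPrev * P.LG * ‖st.x - st.xPrev‖) ^ 2 := sq_le_sq' (abs_le.1 ha).1
    (abs_le.1 ha).2
  have h3 : 1 / (2 * P.delta) * a ^ 2
      ≤ 1 / (2 * P.delta) * (st.sigmaPrev * P.LG * ‖st.x - st.xPrev‖) ^ 2 := by gcongr
  have h4 := mul_le_mul_of_nonneg_left (h1.trans (add_le_add_right h3 _))
    (by positivity : 0 ≤ 1 / P.sigmaBar)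
  refine h4.trans_eq ?_
  field_simp

theorem sigmaPrev_pos : 0 < st.sigmaPrev := by
  rw [v.sigmaPrev_eq]
  exact div_pos (mul_pos h.sigma_pos h.tauBar_pos) v.tauPrev_pos

theorem abs_sigmaPrev_mul_le :
    |st.sigmaPrev * (P.g st.x - P.g st.xPrev)| ≤ st.sigmaPrev * P.LG * ‖st.x - st.xPrev‖ := by
  rw [abs_mul, abs_of_pos (v.sigmaPrev_pos h), mul_assoc]
  exact mul_le_mul_of_nonneg_left (h.lip _ v.x_mem _ v.xPrev_mem) (v.sigmaPrev_pos h).le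

theorem le_energy : P.tauBar / (2 * st.tauPrev ^ 2) * ‖st.x - xs‖ ^ 2
    + (1 - P.delta) / (2 * P.sigmaBar) * (st.y - ys) ^ 2 ≤ energy P xs ys st := by
  have h1 := cross_le h st (y := ys - st.y) (v.abs_sigmaPrev_mul_le h)
  have e1 : 1 / P.sigmaBar * ((ys - st.y) * (st.sigmaPrev * (P.g st.x - P.g st.xPrev)))
    = st.sigmaPrev / P.sigmaBar * (ys - st.y) * (P.g st.x - P.g st.xPrev) := by ring
  have e2 : (1 - P.delta) / (2 * P.sigmaBar) * (st.y - ys) ^ 2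
      = 1 / (2 * P.sigmaBar) * (st.y - ys) ^ 2 - P.delta / (2 * P.sigmaBar) * (ys - st.y) ^ 2 := by
    ring
  rw [e1] at h1
  unfold energy
  linarith

/-- The upper counterpart of `le_energy`: the energy is small as soon as both distances and the last
step are. -/
theorem energy_le : energy P xs ys st ≤ P.tauBar / (2 * st.tauPrev ^ 2) * ‖st.x - xs‖ ^ 2
    + (1 + P.delta) / (2 * P.sigmaBar) * (st.y - ys) ^ 2
    + st.sigmaPrev ^ 2 * P.LG ^ 2 / (P.delta * P.sigmaBar) * ‖st.x - st.xPrev‖ ^ 2 := by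
  have h1 := cross_le h st (y := st.y - ys) (v.abs_sigmaPrev_mul_le h)
  have e1 : 1 / P.sigmaBar * ((st.y - ys) * (st.sigmaPrev * (P.g st.x - P.g st.xPrev)))
    = - (st.sigmaPrev / P.sigmaBar * (ys - st.y) * (P.g st.x - P.g st.xPrev)) := by ring
  have e2 : (1 + P.delta) / (2 * P.sigmaBar) * (st.y - ys) ^ 2
      = 1 / (2 * P.sigmaBar) * (st.y - ys) ^ 2 + P.delta / (2 * P.sigmaBar) * (st.y - ys) ^ 2 := by
    ring
  have hδ := h.delta_mem.1.ne'
  have hS := h.sigma_pos.ne'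
  have e3 : st.sigmaPrev ^ 2 * P.LG ^ 2 / (P.delta * P.sigmaBar) * ‖st.x - st.xPrev‖ ^ 2
      = st.sigmaPrev ^ 2 * P.LG ^ 2 / (2 * P.delta * P.sigmaBar) * ‖st.x - st.xPrev‖ ^ 2
      + st.sigmaPrev ^ 2 * P.LG ^ 2 / (2 * P.delta * P.sigmaBar) * ‖st.x - st.xPrev‖ ^ 2 := by
    field_simp; ring
  rw [e1] at h1
  unfold energy
  linarith

theorem energy_step (k : ℕ) :
    st.sigma / P.sigmaBar * (ys * P.mu / 2 * ‖P.nextX st - xs‖ ^ 2)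
      + P.nu0 * (P.tauBar / (2 * st.tau ^ 2)) * ‖P.nextX st - st.x‖ ^ 2
      + energy P xs ys (P.step k st) ≤ energy P xs ys st := by
  have hS := h.sigma_pos
  have hτ := v.tau_pos
  have hτp := v.tauPrev_pos
  have hτb := h.tauBar_pos
  have hδ := h.delta_mem.1
  -- The product `σ_k * τ_k` is constant, so the averaging weight `t_k` equals `P.tauBar / st.tau`.
  have hσ : st.sigma * (1 / P.sigmaBar) = P.tauBar / st.tau := by
    rw [v.sigma_eq]; field_simp
  have hα : 0 ≤ st.sigma * (1 / P.sigmaBar) := by rw [hσ]; positivity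
  have hQ : P.tauBar / (2 * st.tau ^ 2)
      = st.sigma * (1 / P.sigmaBar) * (1 / (2 * st.tau)) := by
    rw [hσ]; field_simp
  have hcurv : st.sigma * (1 / P.sigmaBar) * (1 / (2 * st.tau) - st.rho / 2)
      ≤ P.tauBar / (2 * st.tauPrev ^ 2) := by
    have h1 := mul_le_mul_of_nonneg_right v.curvature (by positivity : 0 ≤ P.tauBar / 2)
    have e1 : (1 - st.rho * st.tau) / st.tau ^ 2 * (P.tauBar / 2)
        = P.tauBar / st.tau * (1 / (2 * st.tau) - st.rho / 2) := by field_simp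
    have e2 : 1 / st.tauPrev ^ 2 * (P.tauBar / 2) = P.tauBar / (2 * st.tauPrev ^ 2) := by
      field_simp
    rwa [hσ, ← e1, ← e2]
  -- The choice of `tauBar` enters here: the `LXY` and `LG` terms use at most the fraction `1 - ν₀`
  -- of the proximal term.
  have hV : st.sigma * (1 / P.sigmaBar) * (P.LXY / 2)
      + st.sigma ^ 2 * P.LG ^ 2 / (2 * P.delta * P.sigmaBar)
      + P.nu0 * (st.sigma * (1 / P.sigmaBar) * (1 / (2 * st.tau)))
      ≤ st.sigma * (1 / P.sigmaBar) * (1 / (2 * st.tau)) := by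
    rw [← hQ, hσ]
    have e : P.tauBar / st.tau * (P.LXY / 2)
        + st.sigma ^ 2 * P.LG ^ 2 / (2 * P.delta * P.sigmaBar)
        + P.nu0 * (P.tauBar / (2 * st.tau ^ 2))
        = P.tauBar / (2 * st.tau ^ 2) * (st.tau * P.LXY
          + P.tauBar * (P.LG ^ 2 * P.sigmaBar / P.delta) + P.nu0) := by
      rw [v.sigma_eq]; field_simp
    rw [e]
    refine mul_le_of_le_one_right (by positivity) ?_
    have h1 := h.tauBar_mul
    have h2 := mul_le_mul_of_nonneg_right (v.tau_le.trans v.tauPrev_le) h.LXY_pos.le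
    linarith
  have e1 : energy P xs ys (P.step k st) = P.tauBar / (2 * st.tau ^ 2) * ‖P.nextX st - xs‖ ^ 2
      + 1 / (2 * P.sigmaBar) * (P.nextY st - ys) ^ 2
      - st.sigma / P.sigmaBar * (ys - P.nextY st) * (P.g (P.nextX st) - P.g st.x)
      + st.sigma ^ 2 * P.LG ^ 2 / (2 * P.delta * P.sigmaBar) * ‖P.nextX st - st.x‖ ^ 2 := rfl
  have eκ : 1 / (2 * P.sigmaBar) = 1 / P.sigmaBar / 2 := by field_simp
  have eδ : P.delta / (2 * P.sigmaBar) = P.delta * (1 / P.sigmaBar / 2) := by field_simp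
  have hIII := cross_le h st (y := P.nextY st - st.y) (v.abs_sigmaPrev_mul_le h)
  rw [eδ] at hIII
  rw [e1, energy, hQ, eκ, div_eq_mul_one_div st.sigma, div_eq_mul_one_div st.sigmaPrev]
  exact energy_algebra hα (by positivity) h.delta_mem.2.le (sq_nonneg _) (sq_nonneg _)
    (v.primal_step h) (v.nextY_spec h).2 hIII hcurv hV

end State.Valid

/-! ### One epoch: the joint invariant and the growth of the step sizes. -/

/-- Admissible inputs of an epoch. -/
structure EpochInput.Valid {B : ℕ} {d : Fin B → ℕ} (P : Data d) (ys : ℝ) (e : EpochInput d) :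
    Prop where
  x_mem : e.x ∈ P.X
  y_mem : |e.y| ≤ P.cBar
  rho_nonneg : 0 ≤ e.rho
  rho_le : e.rho ≤ ys * P.mu

/-- Jensen's inequality for the squared norm, multiplied by the total weight so that `s = 0`, the
case `T_0 = 0`, is covered. -/
theorem mul_sq_norm_average_le {E : Type*} [NormedAddCommGroup E] [NormedSpace ℝ E] {s t : ℝ}
    (hs : 0 ≤ s) (ht : 0 < t) (a b c : E) :
    (s + t) * ‖(s + t)⁻¹ • (s • a + t • b) - c‖ ^ 2
      ≤ s * ‖a - c‖ ^ 2 + t * ‖b - c‖ ^ 2 := by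
  have hst : 0 < s + t := by linarith
  have e1 : (s + t)⁻¹ • (s • a + t • b) - c = (s + t)⁻¹ • (s • (a - c) + t • (b - c)) := by
    have : c = (s + t)⁻¹ • ((s + t) • c) := by rw [inv_smul_smul₀ hst.ne']
    nth_rewrite 1 [this]
    rw [← smul_sub]
    congr 1
    module
  have h1 : ‖s • (a - c) + t • (b - c)‖ ≤ s * ‖a - c‖ + t * ‖b - c‖ := by
    refine (norm_add_le _ _).trans_eq ?_
    rw [norm_smul, norm_smul, Real.norm_of_nonneg hs, Real.norm_of_nonneg ht.le]
  have h2 : ‖s • (a - c) + t • (b - c)‖ ^ 2 ≤ (s * ‖a - c‖ + t * ‖b - c‖) ^ 2 := by gcongr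
  have h3 : (s * ‖a - c‖ + t * ‖b - c‖) ^ 2
      ≤ (s + t) * (s * ‖a - c‖ ^ 2 + t * ‖b - c‖ ^ 2) := by
    have : 0 ≤ s * t * (‖a - c‖ - ‖b - c‖) ^ 2 := by positivity
    linarith
  rw [e1, norm_smul, mul_pow, Real.norm_of_nonneg (by positivity)]
  calc (s + t) * ((s + t)⁻¹ ^ 2 * ‖s • (a - c) + t • (b - c)‖ ^ 2)
      = (s + t)⁻¹ * ‖s • (a - c) + t • (b - c)‖ ^ 2 := by field_simp
    _ ≤ (s + t)⁻¹ * ((s + t) * (s * ‖a - c‖ ^ 2 + t * ‖b - c‖ ^ 2)) := by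
        gcongr; exact h2.trans h3
    _ = _ := by rw [inv_mul_cancel_left₀ hst.ne']

variable {B : ℕ} {d : Fin B → ℕ} {P : Data d} {xs : BlockSpace d} {ys : ℝ}

theorem Data.rho_le_nextRho (k : ℕ) (st : State d) : st.rho ≤ P.nextRho k st := le_max_left _ _

section

variable (h : KKTSetting P xs ys)
include h

theorem State.Valid.energy_nonneg {st : State d} (v : st.Valid P ys) :
    0 ≤ energy P xs ys st := by
  have hτp := v.tauPrev_pos
  have := h.tauBar_pos
  have := h.sigma_pos
  have : 0 ≤ 1 - P.delta := by linarith [h.delta_mem.2]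
  refine le_trans ?_ (v.le_energy h)
  positivity

theorem State.Valid.sq_norm_sub_le {st : State d} (v : st.Valid P ys) {D : ℝ}
    (hD : energy P xs ys st ≤ D) :
    ‖st.x - xs‖ ^ 2 ≤ 2 * (st.tauPrev ^ 2 / P.tauBar * D) := by
  have hτp := v.tauPrev_pos
  have hτ := h.tauBar_pos
  have hS := h.sigma_pos
  have h1 : 0 ≤ (1 - P.delta) / (2 * P.sigmaBar) * (st.y - ys) ^ 2 := by
    have : 0 ≤ 1 - P.delta := by linarith [h.delta_mem.2]
    positivity
  have h2 : P.tauBar / (2 * st.tauPrev ^ 2) * ‖st.x - xs‖ ^ 2 ≤ D := by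
    linarith [v.le_energy h]
  have h3 := mul_le_mul_of_nonneg_left h2
    (by positivity : 0 ≤ 2 * st.tauPrev ^ 2 / P.tauBar)
  have e : 2 * st.tauPrev ^ 2 / P.tauBar * (P.tauBar / (2 * st.tauPrev ^ 2) * ‖st.x - xs‖ ^ 2)
      = ‖st.x - xs‖ ^ 2 := by field_simp
  rw [e] at h3
  exact h3.trans_eq (by ring)

theorem State.Valid.sq_abs_sub_le {st : State d} (v : st.Valid P ys) {D : ℝ}
    (hD : energy P xs ys st ≤ D) :
    (st.y - ys) ^ 2 ≤ 2 * P.sigmaBar / (1 - P.delta) * D := by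
  have hτp := v.tauPrev_pos
  have hτ := h.tauBar_pos
  have hS := h.sigma_pos
  have hδ : 0 < 1 - P.delta := by linarith [h.delta_mem.2]
  have h1 : 0 ≤ P.tauBar / (2 * st.tauPrev ^ 2) * ‖st.x - xs‖ ^ 2 := by positivity
  have h2 : (1 - P.delta) / (2 * P.sigmaBar) * (st.y - ys) ^ 2 ≤ D := by
    linarith [v.le_energy h]
  have h3 := mul_le_mul_of_nonneg_left h2
    (by positivity : 0 ≤ 2 * P.sigmaBar / (1 - P.delta))
  have e : 2 * P.sigmaBar / (1 - P.delta) * ((1 - P.delta) / (2 * P.sigmaBar) * (st.y - ys) ^ 2)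
      = (st.y - ys) ^ 2 := by field_simp
  rwa [e] at h3

theorem State.Valid.nextRho_le {st : State d} (v : st.Valid P ys) {k : ℕ}
    (hE : energy P xs ys st + ys * P.mu / 2 * (st.T * ‖st.xBar - xs‖ ^ 2) ≤ P.DeltaXY)
    (hk : k = 0 ∨ 0 < st.T) : P.nextRho k st ≤ ys * P.mu := by
  have hτp := v.tauPrev_pos
  have hτ := h.tauBar_pos
  have hS := h.sigma_pos
  have hmu := h.mu_pos
  have hys := h.ys_pos
  have hT := v.T_nonneg
  have hT0 : 0 ≤ ys * P.mu / 2 * (st.T * ‖st.xBar - xs‖ ^ 2) := by positivity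
  have hE0 := v.energy_nonneg h
  have h1 : P.h1 st.x (P.sigmaBar * st.tauPrev * P.DeltaXY / st.sigmaPrev) ≤ ys := by
    refine h.h1_le v.x_mem ?_
    -- With `σ_{k-1} * τ_{k-1} = σ̄ * τ̄`, the argument of `h1` is exactly the bound that the energy
    -- gives for half the squared distance.
    have e : P.sigmaBar * st.tauPrev * P.DeltaXY / st.sigmaPrev
        = st.tauPrev ^ 2 / P.tauBar * P.DeltaXY := by
      rw [v.sigmaPrev_eq]; field_simp
    rw [e]
    exact v.sq_norm_sub_le h (by linarith)
  have h2 : (if k = 0 then 0 else P.h2 st.xBar (P.DeltaXY / st.T)) ≤ ys := by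
    split_ifs with h0
    · exact hys.le
    · have hTpos := hk.resolve_left h0
      refine h.h2_le v.xBar_mem (div_nonneg h.DeltaXY_pos.le hTpos.le) ?_
      rw [← mul_div_assoc, le_div_iff₀ hTpos]
      linarith
  refine max_le v.rho_le ?_
  rw [mul_comm ys]
  exact mul_le_mul_of_nonneg_left (max_le h1 h2) hmu.le

theorem State.Valid.step {st : State d} (v : st.Valid P ys) {k : ℕ}
    (hρ : P.nextRho k st ≤ ys * P.mu) : (P.step k st).Valid P ys := by
  have hτ := v.tau_pos
  have hτb := h.tauBar_pos
  have hS := h.sigma_pos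
  have hσ := v.sigma_pos h
  have hρ0 : 0 ≤ P.nextRho k st := v.rho_nonneg.trans (P.rho_le_nextRho k st)
  obtain ⟨hX, -⟩ := State.Valid.nextX_spec h st
  obtain ⟨⟨hy0, -, hyc⟩, -⟩ := v.nextY_spec h
  obtain ⟨t1, t2, t3, -⟩ := div_sqrt_curvature hρ0 hτ (τ' := P.nextTau k st) rfl
  have ht : 0 < st.sigma / P.sigmaBar := div_pos hσ hS
  have hT := v.T_nonneg
  refine
    { x_mem := hX
      xPrev_mem := v.x_mem
      xBar_mem := ?_
      y_mem := by rw [show (P.step k st).y = P.nextY st from rfl, abs_of_nonneg hy0]; exact hyc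
      rho_nonneg := hρ0
      rho_le := hρ
      tau_pos := t1
      tau_le := t2
      tauPrev_le := v.tau_le.trans v.tauPrev_le
      sigma_eq := ?_
      sigmaPrev_eq := v.sigma_eq
      curvature := t3
      T_nonneg := add_nonneg v.T_nonneg ht.le }
  · have hconv : Convex ℝ P.X := convex_closedBall _ _
    have := hconv v.xBar_mem hX (a := (st.T + st.sigma / P.sigmaBar)⁻¹ * st.T)
      (b := (st.T + st.sigma / P.sigmaBar)⁻¹ * (st.sigma / P.sigmaBar))
      (by positivity) (by positivity) (by
        rw [← mul_add]; exact inv_mul_cancel₀ (by positivity))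
    rw [mul_smul, mul_smul, ← smul_add] at this
    exact this
  · change st.sigma * st.tau / P.nextTau k st = P.sigmaBar * P.tauBar / P.nextTau k st
    rw [v.sigma_eq, div_mul_cancel₀ _ hτ.ne']

variable {e : EpochInput d} (he : e.Valid P ys)
include he

theorem valid_initState : (P.initState e).Valid P ys where
  x_mem := he.x_mem
  xPrev_mem := he.x_mem
  xBar_mem := he.x_mem
  y_mem := he.y_mem
  rho_nonneg := he.rho_nonneg
  rho_le := he.rho_le
  tau_pos := h.tauBar_pos
  tau_le := le_rfl
  tauPrev_le := le_rfl
  sigma_eq := by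
    have := h.tauBar_pos.ne'
    simp only [Data.initState]; field_simp
  sigmaPrev_eq := by
    have := h.tauBar_pos.ne'
    simp only [Data.initState]; field_simp
  curvature := by
    have h1 := h.tauBar_pos
    simp only [Data.initState]
    gcongr
    have := mul_nonneg he.rho_nonneg h1.le
    linarith
  T_nonneg := le_rfl

omit he in
theorem energy_initState (e : EpochInput d) : energy P xs ys (P.initState e)
    = 1 / (2 * P.tauBar) * ‖e.x - xs‖ ^ 2 + 1 / (2 * P.sigmaBar) * (e.y - ys) ^ 2 := by
  have := h.tauBar_pos
  simp only [energy, Data.initState, sub_self, norm_zero, mul_zero, sub_zero]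
  field_simp
  ring

theorem energy_initState_le : energy P xs ys (P.initState e) ≤ P.DeltaXY := by
  have hτ := h.tauBar_pos
  have hS := h.sigma_pos
  rw [energy_initState h, Data.DeltaXY]
  have h1 : (e.y - ys) ^ 2 ≤ P.DY ^ 2 := by
    rw [← sq_abs (e.y - ys)]
    have := h.abs_sub_le_DY he.y_mem
    gcongr
  have h2 : ‖e.x - xs‖ ^ 2 ≤ P.DX ^ 2 := by
    have := h.norm_sub_le_DX he.x_mem
    gcongr
  have h3 : 1 / (2 * P.tauBar) ≤ 1 / P.tauBar := by
    gcongr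
    linarith
  have h4 : 0 ≤ 1 / (2 * P.sigmaBar) := by positivity
  have h5 : 0 ≤ 1 / P.tauBar := by positivity
  exact add_le_add (mul_le_mul h3 h2 (sq_nonneg _) h5) (mul_le_mul_of_nonneg_left h1 h4)

/-- The induction must be joint: the energy bound certifies `ρ_{k+1} ≤ ys * μ`, which in turn keeps
`ys` in the next cut set. The gap terms with weights `t_k` are gathered by Jensen into the term with
`T_k` and `x̄_k` that `h2` requires. -/
theorem run_invariant (k : ℕ) : (P.run e k).Valid P ys ∧
    energy P xs ys (P.run e k) + ys * P.mu / 2 * ((P.run e k).T * ‖(P.run e k).xBar - xs‖ ^ 2)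
      ≤ P.DeltaXY ∧ (k = 0 ∨ 0 < (P.run e k).T) := by
  induction k with
  | zero =>
    refine ⟨valid_initState h he, ?_, Or.inl rfl⟩
    have := energy_initState_le h he
    simpa [Data.run, Data.initState] using this
  | succ k ih =>
    obtain ⟨v, hE, hk⟩ := ih
    have hρ := v.nextRho_le h hE hk
    have ht : 0 < (P.run e k).sigma / P.sigmaBar := div_pos (v.sigma_pos h) h.sigma_pos
    refine ⟨v.step h hρ, ?_, Or.inr (add_pos_of_nonneg_of_pos v.T_nonneg ht)⟩
    have h1 := v.energy_step h k
    have h2 := mul_sq_norm_average_le v.T_nonneg ht (P.run e k).xBar (P.nextX (P.run e k)) xs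
    have h3 : 0 ≤ P.nu0 * (P.tauBar / (2 * (P.run e k).tau ^ 2))
        * ‖P.nextX (P.run e k) - (P.run e k).x‖ ^ 2 := by
      have := h.nu0_mem.1
      have := h.tauBar_pos
      positivity
    have h4 : 0 ≤ ys * P.mu / 2 := by
      have := h.ys_pos
      have := h.mu_pos
      positivity
    have h5 := mul_le_mul_of_nonneg_left h2 h4
    change energy P xs ys (P.step k (P.run e k)) + ys * P.mu / 2 *
      (((P.run e k).T + (P.run e k).sigma / P.sigmaBar)
        * ‖((P.run e k).T + (P.run e k).sigma / P.sigmaBar)⁻¹ •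
          ((P.run e k).T • (P.run e k).xBar
            + ((P.run e k).sigma / P.sigmaBar) • P.nextX (P.run e k)) - xs‖ ^ 2) ≤ _
    linarith

theorem run_valid (k : ℕ) : (P.run e k).Valid P ys := (run_invariant h he k).1

theorem energy_decrease (k : ℕ) :
    P.tauBar / (P.run e k).tau * (ys * P.mu / 2 * ‖(P.run e (k + 1)).x - xs‖ ^ 2)
      + P.nu0 * (P.tauBar / (2 * (P.run e k).tau ^ 2))
        * ‖(P.run e (k + 1)).x - (P.run e k).x‖ ^ 2
      + energy P xs ys (P.run e (k + 1)) ≤ energy P xs ys (P.run e k) := by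
  have v := run_valid h he k
  have h1 := v.energy_step h k
  have e : (P.run e k).sigma / P.sigmaBar = P.tauBar / (P.run e k).tau := by
    have := h.sigma_pos.ne'
    rw [v.sigma_eq]; field_simp
  rwa [e] at h1

theorem energy_antitone : Antitone fun k => energy P xs ys (P.run e k) := by
  refine antitone_nat_of_succ_le fun k => ?_
  have h1 := energy_decrease h he k
  have hτ := (run_valid h he k).tau_pos
  have h2 : 0 ≤ P.tauBar / (P.run e k).tau
      * (ys * P.mu / 2 * ‖(P.run e (k + 1)).x - xs‖ ^ 2)
      + P.nu0 * (P.tauBar / (2 * (P.run e k).tau ^ 2))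
        * ‖(P.run e (k + 1)).x - (P.run e k).x‖ ^ 2 := by
    have := h.nu0_mem.1
    have := h.tauBar_pos
    have := h.ys_pos
    have := h.mu_pos
    positivity
  linarith

/-- At most linear growth of `1 / τ_k` is what produces harmonic weights in
`energy_decrease_scaled`. -/
theorem inv_tau_le (k : ℕ) :
    1 / (P.run e k).tau ≤ 1 / P.tauBar + k * (ys * P.mu / 2) := by
  induction k with
  | zero => simp [Data.run, Data.initState]
  | succ k ih =>
    have v := run_valid h he k
    have v' := run_valid h he (k + 1)
    have h1 := (div_sqrt_curvature (v.rho_nonneg.trans (P.rho_le_nextRho k _)) v.tau_pos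
      (τ' := P.nextTau k (P.run e k)) rfl).2.2.2
    have h2 : P.nextRho k (P.run e k) ≤ ys * P.mu := v'.rho_le
    change 1 / P.nextTau k (P.run e k) ≤ _
    push_cast
    linarith

/-! ### The stopping rule -/

theorem rho_pos (k : ℕ) : 0 < (P.run e (k + 1)).rho := by
  induction k with
  | zero =>
    refine lt_of_lt_of_le ?_ (le_max_right _ _)
    refine mul_pos h.mu_pos (lt_of_lt_of_le ?_ (le_max_left _ _))
    refine mul_pos h.r_pos (inv_pos.2 (add_pos_of_nonneg_of_pos (norm_nonneg _)
      (mul_pos h.LX_pos (Real.sqrt_pos.2 (mul_pos two_pos ?_)))))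
    have v := run_valid h he 0
    exact div_pos (mul_pos (mul_pos h.sigma_pos v.tauPrev_pos) h.DeltaXY_pos) (v.sigmaPrev_pos h)
  | succ k ih => exact ih.trans_le (P.rho_le_nextRho _ _)

omit h he in
theorem rho_mono (e : EpochInput d) : Monotone fun k => (P.run e k).rho :=
  monotone_nat_of_le_succ fun k => P.rho_le_nextRho k (P.run e k)

omit h he in
theorem rhoHat_one (e : EpochInput d) : (P.run e 1).rhoHat = 3 * √((P.run e 1).rho / P.tauBar) := rfl

omit h he in
theorem rhoHat_succ (e : EpochInput d) (k : ℕ) : ((k + 2 : ℕ) : ℝ) * (P.run e (k + 2)).rhoHat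
    = √((((k + 1 : ℕ) : ℝ) * (P.run e (k + 1)).rhoHat) ^ 2
      + 3 * (P.run e (k + 2)).rho * (((k + 1 : ℕ) : ℝ) * (P.run e (k + 1)).rhoHat)) := by
  change ((k + 2 : ℕ) : ℝ) * P.nextRhoHat (k + 1) (P.run e (k + 1)) = _
  rw [Data.nextRhoHat, if_neg k.succ_ne_zero, ← mul_assoc]
  have e1 : ((k + 2 : ℕ) : ℝ) * (1 / (((k + 1 : ℕ) : ℝ) + 1)) = 1 := by
    push_cast
    have : (k : ℝ) + 1 + 1 ≠ 0 := by positivity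
    field_simp
    ring
  rw [e1, one_mul]
  congr 1
  change _ + 3 * (P.run e (k + 2)).rho * _ * _ = _
  ring

/-- For `a_k = k * ρ̂_k` the recursion is `a_{k+1} = √(a_k ^ 2 + 3 * ρ_{k+1} * a_k)`. The squares
grow at least linearly, whence termination; the increments are at most `3 * ρ_{k+1} / 2`, so `ρ̂_k`
is bounded and epochs are long. -/
theorem rhoHat_bounds : ∀ k : ℕ, 0 < (P.run e (k + 1)).rhoHat ∧
    (P.run e 1).rhoHat ^ 2 + k * (3 * (P.run e 1).rho * (P.run e 1).rhoHat)
      ≤ (((k + 1 : ℕ) : ℝ) * (P.run e (k + 1)).rhoHat) ^ 2 ∧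
    (P.run e (k + 1)).rhoHat ≤ 3 * √(ys * P.mu / P.tauBar) + 3 * (ys * P.mu) / 2 := by
  intro k
  have hτ := h.tauBar_pos
  have hC : 0 < ys * P.mu := mul_pos h.ys_pos h.mu_pos
  have hρ1 := rho_pos h he 0
  have h10 : 0 < (P.run e 1).rhoHat := by
    rw [rhoHat_one]
    exact mul_pos three_pos (Real.sqrt_pos.2 (div_pos hρ1 hτ))
  induction k with
  | zero =>
    refine ⟨h10, by simp, ?_⟩
    have h1 : √((P.run e 1).rho / P.tauBar) ≤ √(ys * P.mu / P.tauBar) := by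
      have := (run_valid h he 1).rho_le
      gcongr
    rw [zero_add, rhoHat_one]
    linarith
  | succ k ih =>
    obtain ⟨i1, i2, i3⟩ := ih
    have hs := rhoHat_succ (P := P) e k
    set a := ((k + 1 : ℕ) : ℝ) * (P.run e (k + 1)).rhoHat with ha
    have hk : (0 : ℝ) < ((k + 1 : ℕ) : ℝ) := by positivity
    have ha0 : 0 < a := mul_pos hk i1
    have hρ : (P.run e 1).rho ≤ (P.run e (k + 2)).rho := rho_mono e (by omega)
    have hρC := (run_valid h he (k + 2)).rho_le
    have hrad : 0 < a ^ 2 + 3 * (P.run e (k + 2)).rho * a := by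
      have := hρ1.trans_le hρ
      positivity
    have hk2 : (0 : ℝ) < ((k + 2 : ℕ) : ℝ) := by positivity
    have ha1 : (P.run e 1).rhoHat ≤ a := by
      have h0 : 0 ≤ (k : ℝ) * (3 * (P.run e 1).rho * (P.run e 1).rhoHat) := by
        have : 0 < (P.run e 1).rho := hρ1
        positivity
      exact abs_le_of_sq_le_sq' (by linarith) ha0.le |>.2
    refine ⟨?_, ?_, ?_⟩
    · refine pos_of_mul_pos_right (a := ((k + 2 : ℕ) : ℝ)) ?_ hk2.le
      rw [hs]
      exact Real.sqrt_pos.2 hrad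
    · rw [hs, Real.sq_sqrt hrad.le]
      have h1 : 3 * (P.run e 1).rho * (P.run e 1).rhoHat ≤ 3 * (P.run e (k + 2)).rho * a := by
        have h0 : 0 < (P.run e (k + 2)).rho := hρ1.trans_le hρ
        gcongr
      push_cast
      linarith
    · refine le_of_mul_le_mul_left ?_ hk2
      rw [hs]
      have h1 : √(a ^ 2 + 3 * (P.run e (k + 2)).rho * a) ≤ a + 3 * (ys * P.mu) / 2 := by
        rw [Real.sqrt_le_left (by positivity)]
        nlinarith
      have h2 := mul_le_mul_of_nonneg_left i3 hk.le
      have h3 := Real.sqrt_nonneg (ys * P.mu / P.tauBar)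
      rw [← ha] at h2
      push_cast at h2 ⊢
      linarith

theorem exists_stops (s : ℕ) : ∃ k, P.Stops s e k := by
  have hρ1 := rho_pos h he 0
  have h10 := (rhoHat_bounds h he 0).1
  simp only [zero_add] at hρ1 h10
  set D := 3 * (P.run e 1).rho * (P.run e 1).rhoHat with hD
  have hD0 : 0 < D := by positivity
  set M := max (6 * P.tauBar⁻¹) (√2 ^ s * (3 * √2 * P.DY / (P.DX * √(P.tauBar * P.sigmaBar))))
    with hM
  obtain ⟨k, hk⟩ := exists_nat_gt (M ^ 2 / D)
  refine ⟨k + 1, Nat.le_add_left 1 k, ?_⟩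
  obtain ⟨b1, b2, -⟩ := rhoHat_bounds h he k
  have hM0 : 0 ≤ M := le_max_of_le_left (by have := h.tauBar_pos; positivity)
  have hMk : M ≤ ((k + 1 : ℕ) : ℝ) * (P.run e (k + 1)).rhoHat := by
    refine abs_le_of_sq_le_sq' ?_ (by positivity) |>.2
    rw [div_lt_iff₀ hD0] at hk
    have := sq_nonneg (P.run e 1).rhoHat
    linarith
  -- Both members of the maximum are inversely proportional to `ρ̂`, so the rule reads `M ≤ k *
  -- ρ̂_k` and the linear growth of the square suffices.
  have hsplit : max (6 * ((P.run e (k + 1)).rhoHat * P.tauBar)⁻¹)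
      (√2 ^ s * (3 * √2 * P.DY / ((P.run e (k + 1)).rhoHat * P.DX * √(P.tauBar * P.sigmaBar))))
      = M / (P.run e (k + 1)).rhoHat := by
    rw [hM, ← max_div_div_right b1.le]
    congr 1
    · rw [mul_inv]; ring
    · rw [mul_assoc (P.run e (k + 1)).rhoHat, ← div_div, div_right_comm,
        ← mul_div_assoc (√2 ^ s)]
  rw [Data.target, Nat.ceil_le, hsplit, div_le_iff₀ b1]
  exact hMk

theorem stops_length (s : ℕ) : P.Stops s e (P.length s e) := Nat.sInf_mem (exists_stops h he s)

omit he in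
/-- The lengths of the epochs grow geometrically. -/
theorem exists_le_length : ∃ c : ℝ, 0 < c ∧ ∀ (s : ℕ) (e : EpochInput d), e.Valid P ys →
    c * √2 ^ s ≤ P.length s e := by
  have hDY := h.DY_pos
  have hDX := h.DX_pos
  have hτ := h.tauBar_pos
  have hS := h.sigma_pos
  have hC : 0 < ys * P.mu := mul_pos h.ys_pos h.mu_pos
  set A := 3 * √(ys * P.mu / P.tauBar) + 3 * (ys * P.mu) / 2 with hA
  have hA0 : 0 < A := by positivity
  refine ⟨3 * √2 * P.DY / (A * P.DX * √(P.tauBar * P.sigmaBar)), by positivity, fun s e he => ?_⟩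
  obtain ⟨h1, h2⟩ := stops_length h he s
  obtain ⟨k, hk⟩ := Nat.exists_eq_add_of_le' h1
  obtain ⟨b1, -, b3⟩ := rhoHat_bounds h he k
  rw [hk] at h2 ⊢
  rw [Data.target, Nat.ceil_le] at h2
  refine le_trans ?_ ((le_max_right _ _).trans h2)
  rw [mul_comm]
  gcongr

end

/-! ### Small energy after a uniformly bounded number of iterations. -/

section

variable (h : KKTSetting P xs ys)
include h

/-- The prox subgradient at an iterate near the solution. -/
theorem neg_mem_subdifferential_nextX {st : State d} (hn : ‖P.nextX st - xs‖ < P.zeta) :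
    -(P.nextY st • gradient P.g st.x + (1 / st.tau) • (P.nextX st - st.x))
      ∈ subdifferential P.f (P.nextX st) := by
  obtain ⟨hX, hmin⟩ := State.Valid.nextX_spec h st
  refine neg_mem_subdifferential (convexOn_groupLasso h.p_pos) (S := P.X) ?_ fun z hz => ?_
  -- Strictly within distance `ζ` of `xs` the constraint `𝒳` is inactive and contributes no normal
  -- vector.
  · have : Metric.ball xs P.zeta ∈ 𝓝 (P.nextX st) :=
      Metric.isOpen_ball.mem_nhds (by rwa [Metric.mem_ball, dist_eq_norm])
    filter_upwards [this] with z hz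
    rw [Metric.mem_ball, dist_eq_norm] at hz
    exact h.ball z hz.le
  · have h1 := prox_variational (State.Valid.convexOn_nextX_objective h _) hX hmin hz
    have e1 : 2 * (1 / (2 * st.tau)) = 1 / st.tau := by ring
    rw [e1] at h1
    rw [inner_add_left, inner_smul_left (P.nextX st - st.x), inner_sub_right (P.nextY st • _)]
    simp only [conj_trivial]
    change P.f (P.nextX st) ≤ P.f z + _
    linarith

theorem f_xs_eq : P.f xs = -(ys * inner ℝ (gradient P.g xs) xs) := by
  have := groupLasso_eq_inner h.subgradient
  rwa [inner_neg_left, inner_smul_left] at this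

/-- Euler's identity, applied at `x_{k+1}` and at `xs`, expresses both objective values by pairings
with gradients. Their difference isolates `y_{k+1} - ys` with the coefficient `⟪∇g(xs), xs⟫ = -f(xs)
/ ys`, which is nonzero. -/
theorem abs_nextY_sub_mul_le {st : State d} (v : st.Valid P ys)
    (hn : ‖P.nextX st - xs‖ < P.zeta) :
    |P.nextY st - ys| * (P.f xs / ys)
      ≤ P.cBar * (‖gradient P.g xs‖ * ‖P.nextX st - xs‖)
        + P.cBar * (P.LX * ‖st.x - xs‖ * (‖xs‖ + P.zeta))
        + ‖P.nextX st - st.x‖ / st.tau * (‖xs‖ + P.zeta)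
        + (∑ i, P.p i) * ‖P.nextX st - xs‖ := by
  have hf := h.f_pos
  have hys := h.ys_pos
  have hc := h.cBar_pos
  have hτ := v.tau_pos
  obtain ⟨⟨hy0, -, hyc⟩, -⟩ := v.nextY_spec h
  have h1 : P.f (P.nextX st) = _ :=
    groupLasso_eq_inner (neg_mem_subdifferential_nextX h hn)
  set x' := P.nextX st
  set y' := P.nextY st
  set w := (1 / st.tau) • (x' - st.x) with hw
  have hwn : ‖w‖ = ‖x' - st.x‖ / st.tau := by
    rw [hw, norm_smul, Real.norm_of_nonneg (by positivity), one_div, inv_mul_eq_div]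
  rw [inner_neg_left, inner_add_left, inner_smul_left] at h1
  simp only [conj_trivial] at h1
  have h2 := f_xs_eq h
  have hx'n : ‖x'‖ ≤ ‖xs‖ + P.zeta := by
    have := norm_add_le xs (x' - xs)
    rw [add_sub_cancel] at this
    linarith
  have k1 : |inner ℝ (gradient P.g xs) (xs - x')| ≤ ‖gradient P.g xs‖ * ‖x' - xs‖ := by
    rw [norm_sub_rev]; exact abs_real_inner_le_norm _ _
  have k2 : |inner ℝ (gradient P.g xs - gradient P.g st.x) x'|
      ≤ P.LX * ‖st.x - xs‖ * (‖xs‖ + P.zeta) := by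
    refine (abs_real_inner_le_norm _ _).trans ?_
    rw [norm_sub_rev]
    exact mul_le_mul (h.lip_gradient _ v.x_mem _ h.xs_mem) hx'n (norm_nonneg _)
      (mul_nonneg h.LX_pos.le (norm_nonneg _))
  have k3 : |inner ℝ w x'| ≤ ‖x' - st.x‖ / st.tau * (‖xs‖ + P.zeta) := by
    rw [← hwn]
    exact (abs_real_inner_le_norm _ _).trans (mul_le_mul_of_nonneg_left hx'n (norm_nonneg _))
  have k4 : |P.f x' - P.f xs| ≤ (∑ i, P.p i) * ‖x' - xs‖ := abs_groupLasso_sub_le h.p_pos _ _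
  have hkey : (y' - ys) * (P.f xs / ys) = -(y' * inner ℝ (gradient P.g xs) (xs - x')
      + y' * inner ℝ (gradient P.g xs - gradient P.g st.x) x' - inner ℝ w x'
      - (P.f x' - P.f xs)) := by
    have e : P.f xs / ys = -inner ℝ (gradient P.g xs) xs := by
      rw [h2, neg_div, mul_div_cancel_left₀ _ hys.ne']
    rw [e, inner_sub_right, inner_sub_left, h1, h2]
    ring
  have hmul : ∀ {a b : ℝ}, |a| ≤ b → |y' * a| ≤ P.cBar * b := fun {a b} hab => by
    rw [abs_mul, abs_of_nonneg hy0]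
    exact mul_le_mul hyc hab (abs_nonneg _) hc.le
  rw [← abs_of_pos (div_pos hf hys), ← abs_mul, hkey, abs_neg]
  exact (abs_sub _ _).trans (add_le_add ((abs_sub _ _).trans (add_le_add
    ((abs_add_le _ _).trans (add_le_add (hmul k1) (hmul k2))) k3)) k4)

/-- Near the solution the dual error is controlled by the primal error and the last step. -/
theorem exists_abs_nextY_sub_le : ∃ C : ℝ, 0 ≤ C ∧ ∀ st : State d, st.Valid P ys →
    ‖P.nextX st - xs‖ < P.zeta →
    |P.nextY st - ys| ≤ C * (‖P.nextX st - xs‖ / st.tau + ‖P.nextX st - st.x‖ / st.tau) := by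
  have hf := h.f_pos
  have hys := h.ys_pos
  have hL := h.LX_pos
  have hz := h.zeta_pos
  have hc := h.cBar_pos
  have hτb := h.tauBar_pos
  have hC₀0 : 0 ≤ ∑ i, P.p i := Finset.sum_nonneg fun i _ => (h.p_pos i).le
  refine ⟨ys / P.f xs * (P.tauBar * (P.cBar * ‖gradient P.g xs‖ + ∑ i, P.p i)
    + 2 * (P.tauBar * (P.cBar * (P.LX * (‖xs‖ + P.zeta)))) + (‖xs‖ + P.zeta)),
    by positivity, fun st v hn => ?_⟩
  have hτ := v.tau_pos
  have hττ := v.tau_le.trans v.tauPrev_le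
  have habs := abs_nextY_sub_mul_le h v hn
  have hm : ‖st.x - xs‖ ≤ ‖P.nextX st - xs‖ + ‖P.nextX st - st.x‖ := by
    have := norm_sub_le (P.nextX st - xs) (P.nextX st - st.x)
    rwa [sub_sub_sub_cancel_left] at this
  have hscale : ∀ z : BlockSpace d, ‖z‖ ≤ P.tauBar * (‖z‖ / st.tau) := fun z => by
    rw [← mul_div_assoc, le_div_iff₀ hτ, mul_comm]
    exact mul_le_mul_of_nonneg_right hττ (norm_nonneg _)
  have hn2 := hscale (P.nextX st - xs)
  have hs2 := hscale (P.nextX st - st.x)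
  have hα0 : 0 ≤ ‖P.nextX st - xs‖ / st.tau := by positivity
  have hβ0 : 0 ≤ ‖P.nextX st - st.x‖ / st.tau := by positivity
  generalize ‖P.nextX st - xs‖ / st.tau = α at *
  generalize ‖P.nextX st - st.x‖ / st.tau = β at *
  generalize ‖P.nextX st - xs‖ = n at *
  generalize ‖P.nextX st - st.x‖ = l at *
  have hG : 0 ≤ ‖gradient P.g xs‖ := norm_nonneg _
  have hR : 0 ≤ ‖xs‖ + P.zeta := by positivity
  generalize ‖gradient P.g xs‖ = G at *
  generalize ‖xs‖ + P.zeta = R at *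
  generalize ∑ i, P.p i = C₀ at *
  have hbound : |P.nextY st - ys| * (P.f xs / ys) ≤ (P.tauBar * (P.cBar * G + C₀)
      + 2 * (P.tauBar * (P.cBar * (P.LX * R))) + R) * (α + β) := by
    have b1 := mul_le_mul_of_nonneg_left hn2 (by positivity : 0 ≤ P.cBar * G + C₀)
    have b2 := mul_le_mul_of_nonneg_left (hm.trans (add_le_add hn2 hs2))
        (by positivity : 0 ≤ P.cBar * (P.LX * R))
    have b3 : 0 ≤ P.tauBar * (P.cBar * G + C₀) * β := by positivity
    have b4 : 0 ≤ P.tauBar * (P.cBar * (P.LX * R)) * (α + β) := by positivity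
    have b5 : 0 ≤ R * α := by positivity
    linarith
  have hfin := mul_le_mul_of_nonneg_left hbound (by positivity : 0 ≤ ys / P.f xs)
  have e : ys / P.f xs * (|P.nextY st - ys| * (P.f xs / ys)) = |P.nextY st - ys| := by
    field_simp
  rw [e] at hfin
  linarith

/-- If an iterate and the last step are small relative to the step size, so is the energy. -/
theorem exists_energy_step_le : ∃ C : ℝ, 0 < C ∧ ∀ (st : State d) (k : ℕ) (κ : ℝ),
    st.Valid P ys → (P.step k st).Valid P ys → P.tauBar ^ 2 * κ < P.zeta ^ 2 →
    (‖P.nextX st - xs‖ / st.tau) ^ 2 + (‖P.nextX st - st.x‖ / st.tau) ^ 2 ≤ κ →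
    energy P xs ys (P.step k st) ≤ C * κ := by
  obtain ⟨C₁, hC₁, hdual⟩ := exists_abs_nextY_sub_le h
  have hτb := h.tauBar_pos
  have hS := h.sigma_pos
  have hδ := h.delta_mem.1
  refine ⟨P.tauBar / 2 + (1 + P.delta) / (2 * P.sigmaBar) * (2 * C₁ ^ 2)
    + P.sigmaBar * P.tauBar ^ 2 * P.LG ^ 2 / P.delta, by positivity, fun st k κ v v' hκ hle => ?_⟩
  have hτ := v.tau_pos
  have hττ := v.tau_le.trans v.tauPrev_le
  have hE := v'.energy_le h
  have hdual := hdual st v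
  change energy P xs ys (P.step k st) ≤ P.tauBar / (2 * st.tau ^ 2) * ‖P.nextX st - xs‖ ^ 2
    + (1 + P.delta) / (2 * P.sigmaBar) * (P.nextY st - ys) ^ 2
    + st.sigma ^ 2 * P.LG ^ 2 / (P.delta * P.sigmaBar) * ‖P.nextX st - st.x‖ ^ 2 at hE
  have e1 : P.tauBar / (2 * st.tau ^ 2) * ‖P.nextX st - xs‖ ^ 2
      = P.tauBar / 2 * (‖P.nextX st - xs‖ / st.tau) ^ 2 := by field_simp
  have e2 : st.sigma ^ 2 * P.LG ^ 2 / (P.delta * P.sigmaBar) * ‖P.nextX st - st.x‖ ^ 2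
      = P.sigmaBar * P.tauBar ^ 2 * P.LG ^ 2 / P.delta * (‖P.nextX st - st.x‖ / st.tau) ^ 2 := by
    rw [v.sigma_eq]; field_simp
  have hn : ‖P.nextX st - xs‖ = st.tau * (‖P.nextX st - xs‖ / st.tau) := by field_simp
  rw [e1, e2] at hE
  set α := ‖P.nextX st - xs‖ / st.tau with hα
  set β := ‖P.nextX st - st.x‖ / st.tau with hβ
  have hα0 : 0 ≤ α := by positivity
  have hα2 : α ^ 2 ≤ κ := by linarith [sq_nonneg β]
  have hβ2 : β ^ 2 ≤ κ := by linarith [sq_nonneg α]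
  -- The bound on `κ` places the new iterate where the dual estimate is available.
  have hζ : ‖P.nextX st - xs‖ < P.zeta := by
    refine lt_of_pow_lt_pow_left₀ 2 h.zeta_pos.le (lt_of_le_of_lt ?_ hκ)
    rw [hn, mul_pow]
    gcongr
  have hy : (P.nextY st - ys) ^ 2 ≤ 2 * C₁ ^ 2 * κ := by
    rw [← sq_abs]
    calc |P.nextY st - ys| ^ 2 ≤ (C₁ * (α + β)) ^ 2 := by
          have := hdual hζ
          gcongr
      _ = C₁ ^ 2 * (α + β) ^ 2 := by ring
      _ ≤ C₁ ^ 2 * (2 * κ) := by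
          have : (α + β) ^ 2 ≤ 2 * κ := by nlinarith [sq_nonneg (α - β)]
          gcongr
      _ = _ := by ring
  calc energy P xs ys (P.step k st) ≤ _ := hE
    _ ≤ P.tauBar / 2 * κ + (1 + P.delta) / (2 * P.sigmaBar) * (2 * C₁ ^ 2 * κ)
        + P.sigmaBar * P.tauBar ^ 2 * P.LG ^ 2 / P.delta * κ := by gcongr
    _ = _ := by ring

/-- In units of `τ_k` both gains of `energy_decrease` carry at least a constant times `τ_k`, and
`τ_k` is at least a constant over `k + 1`. -/
theorem energy_decrease_scaled : ∃ c : ℝ, 0 < c ∧ ∀ e : EpochInput d, e.Valid P ys → ∀ k : ℕ,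
    c * (1 / ((k : ℝ) + 1)) * ((‖(P.run e (k + 1)).x - xs‖ / (P.run e k).tau) ^ 2
        + (‖(P.run e (k + 1)).x - (P.run e k).x‖ / (P.run e k).tau) ^ 2)
      + energy P xs ys (P.run e (k + 1)) ≤ energy P xs ys (P.run e k) := by
  have hτb := h.tauBar_pos
  have hν := h.nu0_mem.1
  have hb : 0 < ys * P.mu / 2 := by
    have := h.ys_pos
    have := h.mu_pos
    positivity
  set b := ys * P.mu / 2 with hbdef
  have hc1 : 0 < min (P.tauBar * b) (P.nu0 / 2) := lt_min (by positivity) (by positivity)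
  set c₁ := min (P.tauBar * b) (P.nu0 / 2) with hc₁
  refine ⟨c₁ * (1 / (1 / P.tauBar + b)), by positivity, fun e he k => ?_⟩
  have v := run_valid h he k
  have hτ := v.tau_pos
  have hττ := v.tau_le.trans v.tauPrev_le
  have h1 := energy_decrease h he k
  have h2 := inv_tau_le h he k
  rw [← hbdef] at h1 h2
  set τ := (P.run e k).tau
  set n := ‖(P.run e (k + 1)).x - xs‖
  set m := ‖(P.run e (k + 1)).x - (P.run e k).x‖
  have h3 : 1 / (1 / P.tauBar + b) * (1 / ((k : ℝ) + 1)) ≤ τ := by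
    have e1 : 1 / (1 / P.tauBar + b) * (1 / ((k : ℝ) + 1))
        = 1 / ((1 / P.tauBar + b) * ((k : ℝ) + 1)) := by field_simp
    rw [e1, div_le_iff₀ (by positivity)]
    rw [div_le_iff₀ hτ] at h2
    refine h2.trans ?_
    rw [mul_comm τ]
    gcongr
    have : 0 ≤ 1 / P.tauBar * k := by positivity
    linarith
  have h4 : c₁ * τ * (n / τ) ^ 2 ≤ P.tauBar / τ * (b * n ^ 2) := by
    have e1 : P.tauBar / τ * (b * n ^ 2) = P.tauBar * b * τ * (n / τ) ^ 2 := by field_simp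
    rw [e1]
    have := min_le_left (P.tauBar * b) (P.nu0 / 2)
    gcongr
  have h5 : c₁ * τ * (m / τ) ^ 2 ≤ P.nu0 * (P.tauBar / (2 * τ ^ 2)) * m ^ 2 := by
    have e1 : P.nu0 * (P.tauBar / (2 * τ ^ 2)) * m ^ 2
        = P.nu0 / 2 * P.tauBar * (m / τ) ^ 2 := by field_simp
    rw [e1]
    have := min_le_right (P.tauBar * b) (P.nu0 / 2)
    gcongr
  have h6 : c₁ * (1 / (1 / P.tauBar + b)) * (1 / ((k : ℝ) + 1)) * ((n / τ) ^ 2 + (m / τ) ^ 2)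
      ≤ c₁ * τ * ((n / τ) ^ 2 + (m / τ) ^ 2) := by
    rw [mul_assoc c₁]
    gcongr
  linarith

/-- Otherwise the total decrease would exceed `DeltaXY`, as the harmonic series diverges. It matters
that `K` does not depend on the epoch's input. -/
theorem exists_small_step {κ : ℝ} (hκ : 0 < κ) : ∃ K : ℕ, ∀ e : EpochInput d, e.Valid P ys →
    ∃ k < K, (‖(P.run e (k + 1)).x - xs‖ / (P.run e k).tau) ^ 2
      + (‖(P.run e (k + 1)).x - (P.run e k).x‖ / (P.run e k).tau) ^ 2 ≤ κ := by
  obtain ⟨c, hc, hdec⟩ := energy_decrease_scaled h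
  obtain ⟨K, hK⟩ := (Real.tendsto_sum_range_one_div_nat_succ_atTop.eventually_gt_atTop
    (P.DeltaXY / (c * κ))).exists
  refine ⟨K, fun e he => ?_⟩
  by_contra! hbad
  have hsum : ∀ N ≤ K, c * κ * ∑ i ∈ Finset.range N, 1 / ((i : ℝ) + 1)
      + energy P xs ys (P.run e N) ≤ P.DeltaXY := by
    intro N
    induction N with
    | zero => intro _; simpa [Data.run] using energy_initState_le h he
    | succ N ih =>
      intro hN
      have h1 := ih (by omega)
      have h2 := hdec e he N
      have h3 := mul_le_mul_of_nonneg_left (hbad N hN).le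
        (by positivity : 0 ≤ c * (1 / ((N : ℝ) + 1)))
      rw [Finset.sum_range_succ]
      linarith
  have h1 := hsum K le_rfl
  have h2 := (run_valid h he K).energy_nonneg h
  rw [div_lt_iff₀ (by positivity)] at hK
  linarith

/-- From some length on, the energy at the end of an epoch is small. -/
theorem exists_energy_le {ε : ℝ} (hε : 0 < ε) : ∃ K : ℕ, ∀ e : EpochInput d, e.Valid P ys →
    ∀ N ≥ K, energy P xs ys (P.run e N) ≤ ε := by
  obtain ⟨C, hC, hstep⟩ := exists_energy_step_le h
  have hζ := h.zeta_pos
  have hτ := h.tauBar_pos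
  -- The first entry makes the final bound `ε`; the second, with its factor `2`, gives the strict
  -- inequality demanded by `hstep`.
  set κ := min (ε / C) (P.zeta ^ 2 / (2 * P.tauBar ^ 2)) with hκ
  have hκ0 : 0 < κ := lt_min (by positivity) (by positivity)
  obtain ⟨K, hK⟩ := exists_small_step h hκ0
  refine ⟨K, fun e he N hN => ?_⟩
  obtain ⟨k, hk, hle⟩ := hK e he
  refine (energy_antitone h he (by omega : k + 1 ≤ N)).trans ?_
  have h1 : P.tauBar ^ 2 * κ < P.zeta ^ 2 := by
    have h2 : P.tauBar ^ 2 * κ ≤ P.tauBar ^ 2 * (P.zeta ^ 2 / (2 * P.tauBar ^ 2)) := by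
      gcongr
      exact min_le_right _ _
    have h3 : P.tauBar ^ 2 * (P.zeta ^ 2 / (2 * P.tauBar ^ 2)) = P.zeta ^ 2 / 2 := by field_simp
    have h4 : 0 < P.zeta ^ 2 := by positivity
    linarith
  refine (hstep _ k κ (run_valid h he k) (run_valid h he (k + 1)) h1 hle).trans ?_
  calc C * κ ≤ C * (ε / C) := by
        gcongr
        exact min_le_left _ _
    _ = ε := by field_simp

/-- A restart drops the bilinear and last-step terms and lowers the primal weight; only the dual
weight, of which `le_energy` retains `1 - δ`, costs a factor. -/
theorem energy_initState_le_of_valid {st : State d} (v : st.Valid P ys) :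
    energy P xs ys (P.initState ⟨st.x, st.y, st.rho⟩)
      ≤ 1 / (1 - P.delta) * energy P xs ys st := by
  have hδ : 0 < 1 - P.delta := by linarith [h.delta_mem.2]
  have hδ1 : 1 ≤ 1 / (1 - P.delta) := by
    rw [le_div_iff₀ hδ]; linarith [h.delta_mem.1]
  have hτp := v.tauPrev_pos
  have hτb := h.tauBar_pos
  have hS := h.sigma_pos
  rw [energy_initState h]
  refine le_trans ?_ (mul_le_mul_of_nonneg_left (v.le_energy h) (by positivity))
  have h1 : 1 / (2 * P.tauBar) ≤ P.tauBar / (2 * st.tauPrev ^ 2) := by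
    rw [div_le_div_iff₀ (by positivity) (by positivity)]
    nlinarith [v.tauPrev_le]
  have h2 : 1 / (2 * P.tauBar) * ‖st.x - xs‖ ^ 2
      ≤ 1 / (1 - P.delta) * (P.tauBar / (2 * st.tauPrev ^ 2) * ‖st.x - xs‖ ^ 2) := by
    refine le_trans ?_ (le_mul_of_one_le_left (by positivity) hδ1)
    gcongr
  have e : 1 / (1 - P.delta) * ((1 - P.delta) / (2 * P.sigmaBar) * (st.y - ys) ^ 2)
      = 1 / (2 * P.sigmaBar) * (st.y - ys) ^ 2 := by field_simp
  rw [mul_add, e]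
  exact add_le_add_left h2 _

theorem valid_start (h0 : (P.start 0).Valid P ys) (s : ℕ) : (P.start s).Valid P ys := by
  induction s with
  | zero => exact h0
  | succ s ih =>
    have v := run_valid h ih (P.length s (P.start s))
    exact ⟨v.x_mem, v.y_mem, v.rho_nonneg, v.rho_le⟩

theorem exists_forall_energy_le (h0 : (P.start 0).Valid P ys) {ε : ℝ} (hε : 0 < ε) :
    ∃ S₀ : ℕ, ∀ s ≥ S₀, ∀ k, energy P xs ys (P.run (P.start s) k) ≤ ε := by
  have hδ : 0 < 1 - P.delta := by linarith [h.delta_mem.2]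
  -- The factor `1 - δ` compensates in advance for the loss at the restart.
  obtain ⟨K, hK⟩ := exists_energy_le h (mul_pos hδ hε)
  obtain ⟨c, hc, hlen⟩ := exists_le_length h
  have hgrow : Tendsto (fun s : ℕ => c * √2 ^ s) atTop atTop :=
    (tendsto_pow_atTop_atTop_of_one_lt (by
      rw [Real.lt_sqrt zero_le_one]; norm_num)).const_mul_atTop hc
  obtain ⟨S, hS⟩ := eventually_atTop.1 (hgrow.eventually_ge_atTop (K : ℝ))
  -- Smallness at the end of one epoch is inherited by the whole next epoch, hence the shift by one.
  refine ⟨S + 1, fun s hs k => ?_⟩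
  obtain ⟨s, rfl⟩ := Nat.exists_eq_add_of_le' (by omega : 1 ≤ s)
  have hv := valid_start h h0 s
  have h1 : K ≤ P.length s (P.start s) := by
    exact_mod_cast (hS s (by omega)).trans (hlen s _ hv)
  have h2 := hK _ hv _ h1
  have h3 := energy_antitone h (valid_start h h0 (s + 1)) (Nat.zero_le k)
  refine h3.trans ((energy_initState_le_of_valid h (run_valid h hv _)).trans ?_)
  calc _ ≤ 1 / (1 - P.delta) * ((1 - P.delta) * ε) := by gcongr
    _ = ε := by field_simp

/-! ### Identification of the zero blocks. -/

/-- Small energy identifies the zero blocks. -/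
theorem exists_identification (hlt : ∀ i, xs i = 0 → ‖(ys • gradient P.g xs) i‖ < P.p i) :
    ∃ ε : ℝ, 0 < ε ∧ ∀ (e : EpochInput d), e.Valid P ys → ∀ k,
      energy P xs ys (P.run e k) ≤ ε → ∀ i, xs i = 0 → (P.run e (k + 1)).x i = 0 := by
  have hτb := h.tauBar_pos
  have hS := h.sigma_pos
  have hδ : 0 < 1 - P.delta := by linarith [h.delta_mem.2]
  have hν := h.nu0_mem.1
  have hc := h.cBar_pos
  have hL := h.LX_pos
  -- With energy at most `q ^ 2`, these constants times `q` bound the primal distance, the dual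
  -- distance and the last step over `τ_k`; `C * q` bounds the resulting error in the subgradient.
  set A := √(2 * P.tauBar) with hA
  set A' := √(2 * P.sigmaBar / (1 - P.delta)) with hA'
  set A'' := √(2 / (P.nu0 * P.tauBar)) with hA''
  set C := P.cBar * (P.LX * A) + A' * ‖gradient P.g xs‖ + A'' with hC
  have hsmall : ∀ a b : ℝ, 0 < b → ∀ᶠ q : ℝ in 𝓝[>] 0, a * q < b := fun a b hb => by
    have : Tendsto (fun q : ℝ => a * q) (𝓝 0) (𝓝 (a * 0)) := Continuous.tendsto (by fun_prop) 0
    rw [mul_zero] at this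
    exact nhdsWithin_le_nhds (this.eventually_lt_const hb)
  have hall : ∀ᶠ q : ℝ in 𝓝[>] 0, ∀ i, xs i = 0 →
      C * q < P.p i - ‖(ys • gradient P.g xs) i‖ := by
    refine eventually_all.2 fun i => ?_
    by_cases hi : xs i = 0
    · filter_upwards [hsmall C _ (sub_pos.2 (hlt i hi))] with q hq _ using hq
    · exact Eventually.of_forall fun q hi' => absurd hi' hi
  obtain ⟨q, ⟨hq1, hq2⟩, hq0⟩ :=
    (((hsmall A _ h.zeta_pos).and hall).and self_mem_nhdsWithin).exists
  have hq0 : 0 < q := hq0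
  refine ⟨q ^ 2, by positivity, fun e he k hE i hi => ?_⟩
  have v := run_valid h he k
  have v' := run_valid h he (k + 1)
  have hE' : energy P xs ys (P.run e (k + 1)) ≤ q ^ 2 :=
    (energy_antitone h he (Nat.le_succ k)).trans hE
  have hroot : ∀ {a b : ℝ}, 0 ≤ b → a ^ 2 ≤ b * q ^ 2 → a ≤ √b * q := fun {a b} hb hab => by
    refine abs_le_of_sq_le_sq' ?_ (by positivity) |>.2
    rwa [mul_pow, Real.sq_sqrt hb]
  have hdist : ∀ {st : State d}, st.Valid P ys → energy P xs ys st ≤ q ^ 2 →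
      ‖st.x - xs‖ ≤ A * q := fun {st} w hw => by
    refine hroot (by positivity) ((w.sq_norm_sub_le h hw).trans ?_)
    have h1 : st.tauPrev ^ 2 / P.tauBar ≤ P.tauBar := by
      rw [div_le_iff₀ hτb]
      nlinarith [w.tauPrev_le, w.tauPrev_pos]
    rw [mul_assoc]
    gcongr
  have hm := hdist v hE
  have hn := hdist v' hE'
  have hy : |(P.run e (k + 1)).y - ys| ≤ A' * q := by
    refine hroot (by positivity) ?_
    rw [sq_abs]
    exact v'.sq_abs_sub_le h hE'
  have hτ := v.tau_pos
  have hw : ‖(P.run e (k + 1)).x - (P.run e k).x‖ / (P.run e k).tau ≤ A'' * q := by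
    refine hroot (by positivity) ?_
    have h1 := energy_decrease h he k
    have h2 : 0 ≤ P.tauBar / (P.run e k).tau
        * (ys * P.mu / 2 * ‖(P.run e (k + 1)).x - xs‖ ^ 2) := by
      have := h.ys_pos
      have := h.mu_pos
      positivity
    have h3 := v'.energy_nonneg h
    have h4 := mul_le_mul_of_nonneg_left (by linarith :
      P.nu0 * (P.tauBar / (2 * (P.run e k).tau ^ 2))
        * ‖(P.run e (k + 1)).x - (P.run e k).x‖ ^ 2 ≤ q ^ 2)
      (by positivity : 0 ≤ 2 / (P.nu0 * P.tauBar))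
    refine le_trans (le_of_eq ?_) h4
    field_simp
  have hsub := neg_mem_subdifferential_nextX h (st := P.run e k) (hn.trans_lt hq1)
  by_contra hne
  have hle := le_norm_of_mem_subdifferential hsub hne
  change P.p i ≤ ‖(-((P.run e (k + 1)).y • gradient P.g (P.run e k).x
    + (1 / (P.run e k).tau) • ((P.run e (k + 1)).x - (P.run e k).x))) i‖ at hle
  rw [PiLp.neg_apply, norm_neg] at hle
  set u := (P.run e (k + 1)).y • (gradient P.g (P.run e k).x - gradient P.g xs) with hu
  set u' := ((P.run e (k + 1)).y - ys) • gradient P.g xs with hu'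
  set w := (1 / (P.run e k).tau) • ((P.run e (k + 1)).x - (P.run e k).x) with hwdef
  -- The negated proximal subgradient is its limit `ys • ∇g(xs)` plus three errors: gradient,
  -- multiplier and proximal step.
  have hdec : (P.run e (k + 1)).y • gradient P.g (P.run e k).x + w
      = ys • gradient P.g xs + (u + u' + w) := by
    rw [hu, hu']; module
  rw [hdec, PiLp.add_apply] at hle
  have hu1 : ‖u‖ ≤ P.cBar * (P.LX * A) * q := by
    rw [hu, norm_smul, mul_assoc, mul_assoc]
    refine mul_le_mul v'.y_mem ?_ (norm_nonneg _) hc.le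
    exact (h.lip_gradient _ v.x_mem _ h.xs_mem).trans (mul_le_mul_of_nonneg_left hm hL.le)
  have hu2 : ‖u'‖ ≤ A' * ‖gradient P.g xs‖ * q := by
    rw [hu', norm_smul, mul_right_comm]
    exact mul_le_mul_of_nonneg_right hy (norm_nonneg _)
  have hu3 : ‖w‖ ≤ A'' * q := by
    rw [hwdef, norm_smul, Real.norm_of_nonneg (by positivity), one_div, inv_mul_eq_div]
    exact hw
  have hsum : ‖(u + u' + w) i‖ ≤ C * q := by
    refine (PiLp.norm_apply_le _ i).trans ((norm_add₃_le).trans ?_)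
    rw [hC]
    linarith
  have := hq2 i hi
  have := norm_add_le ((ys • gradient P.g xs) i) ((u + u' + w) i)
  linarith

end

/-! ### From the hypotheses of the theorem to the KKT setting. -/

theorem norm_sub_le_of_nonpos {E : Type*} [NormedAddCommGroup E] [InnerProductSpace ℝ E]
    {g : E → ℝ} {m : ℝ} (hm : 0 < m) (hg : StrongConvexOn univ m g) {x : E}
    (hx : ∀ z, g x ≤ g z) {z : E} (hz : g z ≤ 0) : ‖z - x‖ ≤ √(-2 * g x / m) := by
  refine Real.le_sqrt_of_sq_le ?_
  rw [le_div_iff₀ hm]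
  linarith [sq_norm_sub_le_of_strongConvexOn hg hx z]

/-- Both `xs` and `xTilde` are feasible, hence within `√(-2 * g(xMin) / μ)` of `xMin`. This explains
the factor `2` in the radius and leaves `ζ` to spare. -/
theorem Data.mem_X_of_norm_sub_le (hmu : 0 < P.mu) (hg : StrongConvexOn univ P.mu P.g)
    (hxMin : ∀ x, P.g P.xMin ≤ P.g x) (hslater : P.g P.xTilde ≤ 0) (hfeas : P.g xs ≤ 0)
    {x : BlockSpace d} (hx : ‖x - xs‖ ≤ P.zeta) : x ∈ P.X := by
  rw [Data.X, Metric.mem_closedBall, dist_eq_norm]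
  have h1 := norm_sub_le_of_nonpos hmu hg hxMin hfeas
  have h2 := norm_sub_le_of_nonpos hmu hg hxMin hslater
  rw [norm_sub_rev] at h2
  have e : x - P.xTilde = (x - xs) + (xs - P.xMin) + (P.xMin - P.xTilde) := by abel
  rw [e]
  refine norm_add₃_le.trans ?_
  linarith

/-- With multiplier zero, `xs` would minimize `f` itself and would have to be infeasible. -/
theorem multiplier_pos (hinfeas : ∀ x₀, (∀ x, P.f x₀ ≤ P.f x) → 0 < P.g x₀)
    (hsol : IsSolution P.f P.g xs) (hmult : IsMultiplier P.f P.g xs ys) : 0 < ys := by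
  refine hmult.1.lt_of_ne' fun h0 => ?_
  refine (hinfeas xs fun x => ?_).not_ge hsol.1
  have := hmult.2.1 x
  simpa [lagrangian, h0] using this

/-- The minimality of the Lagrangian at `xs` is tested at the Slater point. -/
theorem multiplier_le_cBar (hp : ∀ i, 0 < P.p i) (hslater : P.g P.xTilde < 0)
    (hmult : IsMultiplier P.f P.g xs ys) : ys ≤ P.cBar := by
  rw [Data.cBar, le_div_iff₀ (by linarith)]
  have h1 := hmult.2.1 P.xTilde
  have h2 : ⨅ x, P.f x ≤ P.f xs :=
    ciInf_le ⟨0, by rintro _ ⟨x, rfl⟩; exact groupLasso_nonneg hp x⟩ xs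
  simp only [lagrangian, hmult.2.2, inner_zero_left] at h1
  linarith

theorem objective_pos (hp : ∀ i, 0 < P.p i)
    (hinfeas : ∀ x₀, (∀ x, P.f x₀ ≤ P.f x) → 0 < P.g x₀) (hfeas : P.g xs ≤ 0) : 0 < P.f xs := by
  refine groupLasso_pos hp ?_
  rintro rfl
  refine (hinfeas 0 fun x => ?_).not_ge hfeas
  rw [Data.f, groupLasso_zero]
  exact groupLasso_nonneg hp x

end RAPDPro

end

theorem theorem4 {B : ℕ} {d : Fin B → ℕ} (P : RAPDPro.Data d)
    (xstar : RAPDPro.BlockSpace d) (ystar : ℝ)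
    -- the weights are positive and the constraint function is strongly convex
    (hp : ∀ i, 0 < P.p i)
    (hmu : 0 < P.mu) (hg : StrongConvexOn Set.univ P.mu P.g)
    -- strictly feasible point; no minimizer of the objective is feasible
    (hslater : P.g P.xTilde < 0)
    (hinfeas : ∀ x₀, (∀ x, P.f x₀ ≤ P.f x) → 0 < P.g x₀)
    -- the radius of the ball is computed from the minimum of the constraint function
    (hxMin : ∀ x, P.g P.xMin ≤ P.g x)
    -- smoothness of the constraint function on the ball
    (hdiff : ∀ x ∈ P.X, DifferentiableAt ℝ P.g x)
    (hLX : 0 < P.LX) (hLG : 0 < P.LG)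
    (hgrad : ∀ x ∈ P.X, ∀ x' ∈ P.X,
      ‖gradient P.g x - gradient P.g x'‖ ≤ P.LX * ‖x - x'‖)
    (hlip : ∀ x ∈ P.X, ∀ x' ∈ P.X, ‖P.g x - P.g x'‖ ≤ P.LG * ‖x - x'‖)
    -- optimal solution, its multiplier, non-degeneracy
    (hsol : RAPDPro.IsSolution P.f P.g xstar)
    (hmult : RAPDPro.IsMultiplier P.f P.g xstar ystar)
    (hnondeg : RAPDPro.IsNondegenerate P.f P.g xstar ystar)
    -- the known lower bound on the subgradients at the solution
    (hr : 0 < P.r) (hr_le : ∀ ξ ∈ RAPDPro.subdifferential P.f xstar, P.r ≤ ‖ξ‖)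
    -- admissible inputs of the algorithm
    (hsigma : 0 < P.sigmaBar)
    (hnu0 : P.nu0 ∈ Set.Ioo (0 : ℝ) 1) (hdelta : P.delta ∈ Set.Ioo (0 : ℝ) 1)
    (hxInit : P.xInit ∈ P.X) (hyInit : P.yInit ∈ P.Y)
    (hrhoInit : 0 ≤ P.rhoInit) (hrhoInit_le : P.rhoInit ≤ ystar * P.mu)
    -- enlargement of the ball
    (hzeta : 0 < P.zeta)
    (hzeta_eta : RAPDPro.etaRadius P.p P.g xstar ystar * P.tauBar
      < 3 * P.LXY * (P.tauBar + (2 * P.LXY)⁻¹) * P.zeta) :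
    -- every epoch consists of finitely many iterations, and from some epoch on
    -- all iterates have the zero blocks of the solution
    (∀ s, ∃ k, P.Stops s (P.start s) k) ∧
      ∃ S₀ : ℕ, ∀ s ≥ S₀, ∀ k ∈ Finset.Icc 1 (P.N s), ∀ i ∈ RAPDPro.activeSet P.p xstar,
        P.iterX s k i = xstar i ∧ xstar i = 0 := by
  have hys := RAPDPro.multiplier_pos hinfeas hsol hmult
  have hball : ∀ x, ‖x - xstar‖ ≤ P.zeta → x ∈ P.X := fun x hx =>
    RAPDPro.Data.mem_X_of_norm_sub_le hmu hg hxMin hslater.le hsol.1 hx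
  have hxs : xstar ∈ P.X := hball xstar (by simpa using hzeta.le)
  have hsub : -(ystar • gradient P.g xstar) ∈ RAPDPro.subdifferential P.f xstar := by
    have := RAPDPro.sub_mem_subdifferential (RAPDPro.convexOn_groupLasso hp) (hdiff xstar hxs)
      hmult.2.1
    rwa [zero_sub] at this
  have h : RAPDPro.KKTSetting P xstar ystar :=
    { p_pos := hp
      mu_pos := hmu
      LX_pos := hLX
      LG_pos := hLG
      sigma_pos := hsigma
      nu0_mem := hnu0
      delta_mem := hdelta
      zeta_pos := hzeta
      r_pos := hr
      ys_pos := hys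
      ys_le := RAPDPro.multiplier_le_cBar hp hslater hmult
      ball := hball
      g_eq := (mul_eq_zero.1 hmult.2.2).resolve_left hys.ne'
      f_pos := RAPDPro.objective_pos hp hinfeas hsol.1
      subgradient := hsub
      strong := fun x hx => RAPDPro.gradient_add_le_of_strongConvexOn hg (hdiff x hx)
      descent := fun x hx z hz =>
        RAPDPro.le_of_lipschitz_gradient (convex_closedBall _ _) hdiff hgrad hx hz
      lip := hlip
      lip_gradient := hgrad
      r_le := by
        have := hr_le _ hsub
        rwa [norm_neg, norm_smul, Real.norm_of_nonneg hys.le] at this }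
  have h0 : (P.start 0).Valid P ystar := ⟨hxInit, hyInit, hrhoInit, hrhoInit_le⟩
  refine ⟨fun s => RAPDPro.exists_stops h (RAPDPro.valid_start h h0 s) s, ?_⟩
  obtain ⟨ε, hε, hid⟩ := RAPDPro.exists_identification h fun i hi =>
    RAPDPro.norm_lt_of_isNondegenerate hp hmu.le hg (hdiff xstar hxs) hys.le hnondeg hi
  obtain ⟨S₀, hS₀⟩ := RAPDPro.exists_forall_energy_le h h0 hε
  refine ⟨S₀, fun s hs k hk i hi => ?_⟩
  have hxi := RAPDPro.eq_zero_of_mem_activeSet hp hi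
  -- The energy before iteration `k` decides the blocks of `x_{k+1}`; the epoch's starting point
  -- `x_0` is not covered, so the index must be at least `1`.
  obtain ⟨k, rfl⟩ := Nat.exists_eq_add_of_le' (Finset.mem_Icc.1 hk).1
  have hx : P.iterX s (k + 1) i = 0 :=
    hid _ (RAPDPro.valid_start h h0 s) k (hS₀ s hs k) i hxi
  exact ⟨hx.trans hxi.symm, hxi⟩
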